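/- Let $f_1,\dots,f_n:\mathbb{R}^p\to\mathbb{R}$ be differentiable, $L$-smooth ($\|\nabla f_i(x)-\nabla f_i(x')\|\le L\|x-x'\|$) and $\mu$-strongly convex ($f_i(x')\ge f_i(x)+\nabla f_i(x)^T(x'-x)+\frac{\mu}{2}\|x'-x\|^2$, $\mu>0$), and let $x^*$ be the minimizer of $f=\frac1n\sum_i f_i$. Let $W\in\mathbb{R}^{n\times n}$ be nonnegative, symmetric and doubly stochastic with $W_{ii}>0$ for all $i$, such that the graph on $\{1,\dots,n\}$ with an edge $ij$ ($i\ne j$) whenever $W_{ij}>0$ is connected. Let $\beta,\gamma,\delta,\epsilon>0$, $\gamma\beta\le1$, $0<q_1<q_2<1$, $\theta>1$, and for $k\ge1$ put $\alpha_k=\gamma q_1^{k-1}$ and $\nu_k=\frac{\gamma\delta q_2}{\epsilon(q_2-q_1)}q_2^{k-1}$. From a deterministic $\mathbf{x}(0)\in\mathbb{R}^{n\times p}$ (with rows $x_i(0)$) and $y_i(0)=0$, consider for $k\ge1$ $$z_i(k)=x_i(k-1)+\xi_i(k),\quad \bar z_i(k)=\sum_j W_{ij}z_j(k),\quad y_i(k)=y_i(k-1)+\beta(z_i(k)-\bar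 z_i(k)),\quad x_i(k)=\bar z_i(k)-\alpha_k\big(y_i(k)+\nabla f_i(z_i(k))\big),$$ where the coordinates of the noises $\xi_i(k)\in\mathbb{R}^p$ are independent over coordinates, agents $i$ and iterations $k$, and those of $\xi_i(k)$ have the zero-mean Laplace distribution with scale $\nu_k$, i.e. density $t\mapsto\frac{1}{2\nu_k}e^{-|t|/\nu_k}$. Write $\bar x(k)=\frac1n\sum_i x_i(k)$ and $\|\mathbf{x}(k)-\mathbf{1}\bar x(k)\|^2=\sum_i\|x_i(k)-\bar x(k)\|^2$. For $n\times n$ matrices let $\|\cdot\|$ be the spectral norm. Let $$\tilde W(k)=\Big(\tfrac{\alpha_{k+1}}{\alpha_k}-\alpha_{k+1}\beta\Big)I+\Big(1-\tfrac{\alpha_{k+1}}{\alpha_k}+\alpha_{k+1}\beta\Big)W,\qquad \sigma=\sup_{k\ge1}\big\|\tilde W(k)-\tfrac1n\mathbf{1}\mathbf{1}^T\big\|.$$ Suppose that $$48(\theta+1)(2+\sigma^2)(3+\sigma^2)\|W-I\|^2\,q_1^2\le(1-\sigma^2)^4 .$$ Then $\sigma<1$, the expectations below are finite, and $\lim_{k\to\infty}\mathbb{E}\|\mathbf{x}(k)-\mathbf{1}\bar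 x(k)\|^2=0$. Moreover the limit $d=\lim_{k\to\infty}\mathbb{E}\|\bar x(k)-x^*\|^2$ exists, and there are constants $c_1,c_2>0$ with $\mathbb{E}\|\bar x(k)-x^*\|^2\le c_1$ and $\mathbb{E}\|\mathbf{x}(k)-\mathbf{1}\bar x(k)\|^2\le c_2$ for all $k\ge0$ such that $$d\le e^{-\frac{\mu\gamma}{1-q_1}}c_1+\frac{\gamma c_2L^2}{n\mu(1-q_1)}+\frac{2p\delta^2\gamma^2q_2^2}{\epsilon^2(q_2-q_1)^2(1-q_2^2)}+\Big(4pL+\frac{2pL^2}{\mu}\Big)\frac{\delta^2q_2^2\gamma^3}{\epsilon^2(q_2-q_1)^2(1-q_1q_2^2)} .$$ Here $c_1,c_2\le C(1+\epsilon^{-2})$ with a constant $C$ that depends neither on $\epsilon$ nor on the noise, so that $d=O(\epsilon^{-2})$ as $\epsilon\to0$ with all other data fixed. If $\gamma\le\frac{2}{\mu+L}$, the bound on $d$ holds for all $c_1,c_2$ with $\mathbb{E}\|\bar x(k)-x^*\|^2\le c_1$ and $\mathbb{E}\|\mathbf{x}(k)-\mathbf{1}\bar x(k)\|^2\le c_2$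 for all $k\ge0$. -/

import Mathlib

open MeasureTheory ProbabilityTheory Filter
open scoped Topology Gradient

noncomputable section

namespace DPOpt

/-- The decision space `ℝ^p` with the Euclidean norm. -/
abbrev Vec (p : ℕ) : Type := EuclideanSpace ℝ (Fin p)

/-- Stacked variables `[x_1, …, x_n]ᵀ ∈ ℝ^{n × p}`, one row for each agent. -/
abbrev Stack (n p : ℕ) : Type := Fin n → Vec p

/-- `g` is differentiable, `L`-smooth and `μ`-strongly convex on `ℝ^p`. -/
structure IsSmoothStronglyConvex {p : ℕ} (L μ : ℝ) (g : Vec p → ℝ) : Prop where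
  differentiable : Differentiable ℝ g
  smooth : ∀ x x' : Vec p, ‖∇ g x - ∇ g x'‖ ≤ L * ‖x - x'‖
  strongly_convex : ∀ x x' : Vec p,
    g x + inner ℝ (∇ g x) (x' - x) + μ / 2 * ‖x' - x‖ ^ 2 ≤ g x'

/-- The global cost `(1/n) ∑ i, f i`. -/
def globalCost {n p : ℕ} (f : Fin n → Vec p → ℝ) (x : Vec p) : ℝ :=
  (1 / (n : ℝ)) * ∑ i, f i x

/-- The undirected graph induced by a weight matrix: distinct agents are adjacent iff the weight
between them is positive. -/
def inducedGraph {n : ℕ} (W : Matrix (Fin n) (Fin n) ℝ) : SimpleGraph (Fin n) :=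
  SimpleGraph.fromRel fun i j => 0 < W i j

/-- A weight matrix: nonnegative, symmetric and doubly stochastic, with positive self-weights and
connected induced graph. -/
structure IsWeightMatrix {n : ℕ} (W : Matrix (Fin n) (Fin n) ℝ) : Prop where
  nonneg : ∀ i j, 0 ≤ W i j
  symm : W.IsSymm
  row_sum : ∀ i, ∑ j, W i j = 1
  col_sum : ∀ j, ∑ i, W i j = 1
  diag_pos : ∀ i, 0 < W i i
  connected : (inducedGraph W).Connected

/-- The matrix norm induced by the Euclidean norm (the spectral norm). -/
def specNorm {n : ℕ} (M : Matrix (Fin n) (Fin n) ℝ) : ℝ :=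
  ‖Matrix.toEuclideanCLM (n := Fin n) (𝕜 := ℝ) M‖

/-- The averaging matrix `(1/n) 1 1ᵀ`. -/
def averagingMatrix (n : ℕ) : Matrix (Fin n) (Fin n) ℝ :=
  Matrix.of fun _ _ => 1 / (n : ℝ)

/-- The stepsizes `α_k = γ q₁^{k-1}`, for `k ≥ 1`. -/
def stepsize (γ q₁ : ℝ) (k : ℕ) : ℝ := γ * q₁ ^ (k - 1)

/-- The noise scales `ν_k = γ δ q₂ / (ε (q₂ - q₁)) · q₂^{k-1}`, for `k ≥ 1`. -/
def noiseScale (γ q₁ q₂ δ ε : ℝ) (k : ℕ) : ℝ :=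
  γ * δ * q₂ / (ε * (q₂ - q₁)) * q₂ ^ (k - 1)

/-- `W̃(k) = (α_{k+1}/α_k - α_{k+1} β) I + (1 - α_{k+1}/α_k + α_{k+1} β) W`, for `k ≥ 1`. -/
def Wtilde {n : ℕ} (W : Matrix (Fin n) (Fin n) ℝ) (β γ q₁ : ℝ) (k : ℕ) :
    Matrix (Fin n) (Fin n) ℝ :=
  (stepsize γ q₁ (k + 1) / stepsize γ q₁ k - stepsize γ q₁ (k + 1) * β) • 1 +
    (1 - stepsize γ q₁ (k + 1) / stepsize γ q₁ k + stepsize γ q₁ (k + 1) * β) • W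

/-- `σ = sup_{k ≥ 1} ‖W̃(k) - (1/n) 1 1ᵀ‖`. -/
def sigma {n : ℕ} (W : Matrix (Fin n) (Fin n) ℝ) (β γ q₁ : ℝ) : ℝ :=
  ⨆ k : ℕ, specNorm (Wtilde W β γ q₁ (k + 1) - averagingMatrix n)

/-- One iteration of the algorithm from the states `s = (x(k-1), y(k-1))`, with stepsize `α` and
noise `ξ` (the noise of iteration `k`): `z_i = x_i + ξ_i`, `z̄_i = ∑ j, W_{ij} z_j`,
`y_i⁺ = y_i + β (z_i - z̄_i)`, `x_i⁺ = z̄_i - α (y_i⁺ + ∇ f_i (z_i))`. -/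
def algStep {n p : ℕ} (f : Fin n → Vec p → ℝ) (W : Matrix (Fin n) (Fin n) ℝ) (β α : ℝ)
    (ξ : Stack n p) (s : Stack n p × Stack n p) : Stack n p × Stack n p :=
  let z : Stack n p := fun i => s.1 i + ξ i
  let zbar : Stack n p := fun i => ∑ j, W i j • z j
  let y : Stack n p := fun i => s.2 i + β • (z i - zbar i)
  (fun i => zbar i - α • (y i + ∇ (f i) (z i)), y)

/-- The states `(x(k), y(k))` of the algorithm along a noise realization `ξ(1), ξ(2), …`, started
at `x(0) = x₀`, `y(0) = 0`. -/
def algState {n p : ℕ} (f : Fin n → Vec p → ℝ) (W : Matrix (Fin n) (Fin n) ℝ) (β : ℝ)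
    (α : ℕ → ℝ) (x₀ : Stack n p) (ξ : ℕ → Stack n p) : ℕ → Stack n p × Stack n p
  | 0 => (x₀, 0)
  | k + 1 => algStep f W β (α (k + 1)) (ξ (k + 1)) (algState f W β α x₀ ξ k)

/-- The average `x̄ = (1/n) 1ᵀ x` of the rows. -/
def rowAvg {n p : ℕ} (x : Stack n p) : Vec p := (1 / (n : ℝ)) • ∑ i, x i

/-- The squared consensus error `‖x - 1 x̄‖²` (squared Frobenius norm). -/
def consensusErr {n p : ℕ} (x : Stack n p) : ℝ := ∑ i, ‖x i - rowAvg x‖ ^ 2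

/-- The squared optimization error `‖x̄ - x*‖²`. -/
def optErr {n p : ℕ} (xstar : Vec p) (x : Stack n p) : ℝ := ‖rowAvg x - xstar‖ ^ 2

/-- The zero-mean Laplace distribution `Lap(c)` with scale `c > 0`: the law on `ℝ` with density
`t ↦ exp(-|t| / c) / (2 c)`. -/
def laplaceMeasure (c : ℝ) : Measure ℝ :=
  volume.withDensity fun t => ENNReal.ofReal (1 / (2 * c) * Real.exp (-|t| / c))

/-- The noise assumption: the coordinates of `ξ(k)`, `k ≥ 1`, are independent across iterations,
agents and dimensions, and each coordinate of `ξ(k)` has the law `Lap(ν_k)`. -/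
structure IsLaplaceNoise {n p : ℕ} {Ω : Type*} [MeasurableSpace Ω] (P : Measure Ω) (ν : ℕ → ℝ)
    (ξ : ℕ → Ω → Stack n p) : Prop where
  hasLaw : ∀ k, 1 ≤ k → ∀ i j, HasLaw (fun ω => ξ k ω i j) (laplaceMeasure (ν k)) P
  indep : iIndepFun (fun (a : ℕ × Fin n × Fin p) ω => ξ (a.1 + 1) ω a.2.1 a.2.2) P

/-- The explicit bound on the optimization accuracy, with the constants `c₁`, `c₂`. -/
def accuracyBound (n p : ℕ) (L μ γ q₁ q₂ δ ε c₁ c₂ : ℝ) : ℝ :=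
  Real.exp (-(μ * γ / (1 - q₁))) * c₁ + γ * c₂ * L ^ 2 / (n * μ * (1 - q₁)) +
    2 * p * δ ^ 2 * γ ^ 2 * q₂ ^ 2 / (ε ^ 2 * (q₂ - q₁) ^ 2 * (1 - q₂ ^ 2)) +
    (4 * p * L + 2 * p * L ^ 2 / μ) *
      (δ ^ 2 * q₂ ^ 2 * γ ^ 3 / (ε ^ 2 * (q₂ - q₁) ^ 2 * (1 - q₁ * q₂ ^ 2)))

end DPOpt

end

open DPOpt

open DPOpt

/-! Write `J` for the averaging matrix. Connectedness and positive self-weights give `‖W - J‖ < 1`.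
Each `W̃(k) - J` is a convex combination of `I - J` and `W - J` in which the weight of `I - J` is at
most `q₁`, so `σ < 1`.

The convergence statements are pathwise. Since `W` preserves averages, the dual variables keep
average zero, and the mean iterate makes a noisy inexact gradient step. A weighted sum of the
consensus error, the size of the dual variable and the distance of the mean from `x*` grows at most
by a factor `1 + C α` plus `C (‖ξ‖ + α)` (`exists_potential_recursion`). The stepsizes are summable,
and so is the noise almost surely, so a discrete Gronwall argument bounds every state by an affine
function of the total noise (`exists_algState_bound`). Then the deviations contract up to summable
errors and the means form a Cauchy sequence (`algState_tendsto`). A weighted Cauchy-Schwarz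
inequality shows that the total noise is square integrable, with second moment proportional to
`ε⁻²`. Dominated convergence passes to expectations (`exists_expectation_bound`), with a constant
fixed before the probability space is.

The accuracy bound has two sources. If `γ ≤ 2 / (μ + L)`, co-coercivity makes an exact gradient step
a contraction by `1 - α μ`. The noise of the current iteration is centred and independent of the
past, so the cross terms vanish in expectation, and the resulting scalar recursion sums to three
geometric series (`integral_optErr_algState_succ_le`, `le_accuracyBound_of_recursion`). For general
`γ`, the constant `c₁` may be any bound of order `1 + ε⁻²`; enlarging a uniform bound by `exp (μ γ /
(1 - q₁))` makes the first term of the accuracy bound alone exceed `d`. -/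

namespace DPOpt

/-! ### Spectral properties of the weight matrix -/

section Weights

variable {n : ℕ} {W : Matrix (Fin n) (Fin n) ℝ}

lemma IsWeightMatrix.pos (hW : IsWeightMatrix W) : 0 < n := by
  obtain ⟨i⟩ := hW.connected.nonempty
  exact i.pos

/-- Each row of `W` is a probability vector, so the inner sum is a variance; adding over rows, the
second moments collapse by the column sums. -/
lemma IsWeightMatrix.sum_sq_sub (hW : IsWeightMatrix W) (v : Fin n → ℝ) :
    ∑ i, ∑ j, W i j * (v j - ∑ l, W i l * v l) ^ 2
      = ∑ j, v j ^ 2 - ∑ i, (∑ l, W i l * v l) ^ 2 := by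
  have h1 : ∀ i, ∑ j, W i j * (v j - ∑ l, W i l * v l) ^ 2
      = ∑ j, W i j * v j ^ 2 - (∑ l, W i l * v l) ^ 2 := by
    intro i
    set m := ∑ l, W i l * v l with hm
    have : ∀ j, W i j * (v j - m) ^ 2
        = W i j * v j ^ 2 - 2 * m * (W i j * v j) + m ^ 2 * W i j := fun j => by ring
    simp_rw [this, Finset.sum_add_distrib, Finset.sum_sub_distrib, ← Finset.mul_sum, ← hm,
      hW.row_sum i]
    ring
  simp_rw [h1, Finset.sum_sub_distrib]
  rw [Finset.sum_comm]
  simp_rw [← Finset.sum_mul, hW.col_sum, one_mul]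

/-- If `W` does not decrease the norm, all row variances vanish. The positive self-weight identifies
each row mean with the agent's own value, so neighbours agree, and connectedness spreads this to all
agents. -/
lemma IsWeightMatrix.eq_of_sum_sq_le (hW : IsWeightMatrix W) (v : Fin n → ℝ)
    (h : ∑ j, v j ^ 2 ≤ ∑ i, (∑ l, W i l * v l) ^ 2) (i j : Fin n) : v i = v j := by
  have hnn : ∀ i j, 0 ≤ W i j * (v j - ∑ l, W i l * v l) ^ 2 := fun i j =>
    mul_nonneg (hW.nonneg i j) (sq_nonneg _)
  have h0 : ∑ i, ∑ j, W i j * (v j - ∑ l, W i l * v l) ^ 2 = 0 :=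
    le_antisymm (by rw [hW.sum_sq_sub v]; linarith)
      (Finset.sum_nonneg fun i _ => Finset.sum_nonneg fun j _ => hnn i j)
  have h1 : ∀ i j, 0 < W i j → v j = ∑ l, W i l * v l := by
    intro i j hij
    have h2 := (Finset.sum_eq_zero_iff_of_nonneg
      fun i _ => Finset.sum_nonneg fun j _ => hnn i j).1 h0 i (Finset.mem_univ _)
    have h3 := (Finset.sum_eq_zero_iff_of_nonneg fun j _ => hnn i j).1 h2 j (Finset.mem_univ _)
    have h4 : (v j - ∑ l, W i l * v l) ^ 2 = 0 := (mul_eq_zero.1 h3).resolve_left hij.ne'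
    exact sub_eq_zero.1 (pow_eq_zero_iff two_ne_zero |>.1 h4)
  have h2 : ∀ i j, 0 < W i j → v j = v i := fun i j hij =>
    (h1 i j hij).trans (h1 i i (hW.diag_pos i)).symm
  obtain ⟨w⟩ := hW.connected.preconnected i j
  induction w with
  | nil => rfl
  | cons hadj _ ih =>
    rw [← ih]
    rw [inducedGraph, SimpleGraph.fromRel_adj] at hadj
    rcases hadj.2 with h | h
    · exact (h2 _ _ h).symm
    · exact h2 _ _ h

lemma sum_sub_avg_sq (hn : 0 < n) (v : Fin n → ℝ) :
    ∑ i, (v i - ∑ j, 1 / (n : ℝ) * v j) ^ 2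
      = ∑ i, v i ^ 2 - n * (∑ j, 1 / (n : ℝ) * v j) ^ 2 := by
  have hn' : (n : ℝ) ≠ 0 := by positivity
  set m := ∑ j, 1 / (n : ℝ) * v j with hm
  have hs : ∑ i, v i = n * m := by rw [hm, ← Finset.mul_sum]; field_simp
  have : ∀ i, (v i - m) ^ 2 = v i ^ 2 - 2 * m * v i + m ^ 2 := fun i => by ring
  simp_rw [this, Finset.sum_add_distrib, Finset.sum_sub_distrib, ← Finset.mul_sum, hs]
  simp
  ring

lemma specNorm_nonneg (M : Matrix (Fin n) (Fin n) ℝ) : 0 ≤ specNorm M := norm_nonneg _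

lemma norm_toEuclideanCLM_sq (M : Matrix (Fin n) (Fin n) ℝ) (x : EuclideanSpace ℝ (Fin n)) :
    ‖Matrix.toEuclideanCLM (n := Fin n) (𝕜 := ℝ) M x‖ ^ 2 = ∑ i, (∑ j, M i j * x j) ^ 2 := by
  rw [EuclideanSpace.norm_sq_eq]
  simp [Matrix.ofLp_toEuclideanCLM, Matrix.mulVec, dotProduct]

lemma sum_mul_sq_le_specNorm (M : Matrix (Fin n) (Fin n) ℝ) (v : Fin n → ℝ) :
    ∑ i, (∑ j, M i j * v j) ^ 2 ≤ specNorm M ^ 2 * ∑ i, v i ^ 2 := by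
  have h := ContinuousLinearMap.le_opNorm (Matrix.toEuclideanCLM (n := Fin n) (𝕜 := ℝ) M)
    (WithLp.toLp 2 v)
  have h2 := pow_le_pow_left₀ (norm_nonneg _) h 2
  rw [norm_toEuclideanCLM_sq, mul_pow, EuclideanSpace.norm_sq_eq (WithLp.toLp 2 v)] at h2
  simpa [specNorm] using h2

lemma specNorm_one_sub_averagingMatrix_le (hn : 0 < n) :
    specNorm (1 - averagingMatrix n) ≤ 1 := by
  refine ContinuousLinearMap.opNorm_le_bound _ zero_le_one fun x => ?_
  rw [one_mul]
  refine le_of_sq_le_sq ?_ (norm_nonneg _)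
  rw [norm_toEuclideanCLM_sq, EuclideanSpace.norm_sq_eq]
  have : ∀ i, ∑ j, (1 - averagingMatrix n) i j * x j = x i - ∑ j, 1 / (n : ℝ) * x j := by
    intro i
    simp [averagingMatrix, sub_mul, Finset.sum_sub_distrib, Matrix.one_apply]
  simp_rw [this, sum_sub_avg_sq hn, Real.norm_eq_abs, sq_abs]
  have : 0 ≤ (n : ℝ) * (∑ j, 1 / (n : ℝ) * x j) ^ 2 := by positivity
  linarith

/-- `W - J` acts as `W` on the centred vector. Equality of norms would force that vector to be
constant with zero sum, hence zero. Compactness of the unit sphere upgrades the pointwise strict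
inequality to the norm. -/
lemma IsWeightMatrix.specNorm_sub_averagingMatrix_lt (hW : IsWeightMatrix W) :
    specNorm (W - averagingMatrix n) < 1 := by
  have hn := hW.pos
  have hn' : (n : ℝ) ≠ 0 := by positivity
  have : Nonempty (Fin n) := ⟨⟨0, hn⟩⟩
  set T := Matrix.toEuclideanCLM (n := Fin n) (𝕜 := ℝ) (W - averagingMatrix n) with hT
  have key : ∀ x : EuclideanSpace ℝ (Fin n), x ≠ 0 → ‖T x‖ < ‖x‖ := by
    intro x hx
    refine lt_of_pow_lt_pow_left₀ 2 (norm_nonneg _) ?_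
    rw [norm_toEuclideanCLM_sq, EuclideanSpace.norm_sq_eq]
    set m := ∑ j, 1 / (n : ℝ) * x j with hm
    set v : Fin n → ℝ := fun i => x i - m with hv
    have hTv : ∀ i, ∑ j, (W - averagingMatrix n) i j * x j = ∑ l, W i l * v l := by
      intro i
      simp_rw [hv, mul_sub, Finset.sum_sub_distrib, ← Finset.sum_mul, hW.row_sum, one_mul]
      simp [averagingMatrix, sub_mul, Finset.sum_sub_distrib, hm]
    simp_rw [hTv, Real.norm_eq_abs, sq_abs]
    have hsum := sum_sub_avg_sq hn x
    rw [← hm] at hsum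
    have hvx : ∑ i, v i ^ 2 ≤ ∑ i, x i ^ 2 := by
      have : 0 ≤ (n : ℝ) * m ^ 2 := by positivity
      simp only [hv]
      linarith
    by_contra hcon
    push Not at hcon
    have hconst := hW.eq_of_sum_sq_le v (hvx.trans hcon)
    have hv0 : ∀ i, v i = 0 := by
      intro i
      have h1 : ∑ j, v j = 0 := by
        simp only [hv, Finset.sum_sub_distrib, hm, ← Finset.mul_sum]
        simp
        field_simp
        simp
      have h2 : ∑ j, v j = n * v i := by
        rw [Finset.sum_congr rfl fun j _ => hconst j i]
        simp
      rw [h1] at h2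
      exact (mul_eq_zero.1 h2.symm).resolve_left hn'
    simp only [hv0, mul_zero, Finset.sum_const_zero] at hcon
    apply hx
    ext i
    have h3 : ∑ i, x i ^ 2 = 0 :=
      le_antisymm (by simpa using hcon) (Finset.sum_nonneg fun _ _ => sq_nonneg _)
    have := (Finset.sum_eq_zero_iff_of_nonneg fun _ _ => sq_nonneg _).1 h3 i (Finset.mem_univ _)
    simpa using this
  obtain ⟨x, hx, hmax⟩ := (isCompact_sphere (0 : EuclideanSpace ℝ (Fin n)) 1).exists_isMaxOn
    (NormedSpace.sphere_nonempty.2 zero_le_one) (f := fun x => ‖T x‖) (by fun_prop)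
  have hx1 : ‖x‖ = 1 := by simpa using hx
  have hle : ‖T‖ ≤ ‖T x‖ := by
    refine ContinuousLinearMap.opNorm_le_of_unit_norm (norm_nonneg _) fun y hy => ?_
    exact hmax (by simpa using hy)
  have := key x (by rintro rfl; simp at hx1)
  rw [hx1] at this
  exact lt_of_le_of_lt hle this

lemma IsWeightMatrix.sigma_lt_one (hW : IsWeightMatrix W) {β γ q₁ : ℝ} (hβ : 0 < β) (hγ : 0 < γ)
    (hγβ : γ * β ≤ 1) (hq₁ : q₁ ∈ Set.Ioo (0 : ℝ) 1) : sigma W β γ q₁ < 1 := by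
  obtain ⟨h0, h1⟩ := hq₁
  set ρ := specNorm (W - averagingMatrix n) with hρ
  have hρ1 : ρ < 1 := hW.specNorm_sub_averagingMatrix_lt
  have hρ0 : 0 ≤ ρ := specNorm_nonneg _
  refine lt_of_le_of_lt (ciSup_le fun k => ?_) (show q₁ + (1 - q₁) * ρ < 1 by nlinarith)
  have hr : stepsize γ q₁ (k + 1 + 1) / stepsize γ q₁ (k + 1) = q₁ := by
    simp only [stepsize, Nat.add_sub_cancel]
    have : q₁ ^ k ≠ 0 := by positivity
    field_simp
    ring
  -- Here `a = q₁ (1 - γ β q₁ ^ k)`, and `γ β ≤ 1` places it in `[0, q₁]`; this makes the bound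
  -- uniform in `k`.
  set a := q₁ - stepsize γ q₁ (k + 1 + 1) * β with ha
  have hs : stepsize γ q₁ (k + 1 + 1) * β = (γ * β) * q₁ ^ k * q₁ := by
    simp only [stepsize, Nat.add_sub_cancel]
    ring
  have hpk : q₁ ^ k ≤ 1 := pow_le_one₀ h0.le h1.le
  have hpk0 : 0 < q₁ ^ k := by positivity
  have hle : γ * β * q₁ ^ k ≤ 1 := by
    calc γ * β * q₁ ^ k ≤ 1 * 1 := by gcongr
      _ = 1 := one_mul 1
  have ha0 : 0 ≤ a := by rw [ha, hs]; nlinarith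
  have haq : a ≤ q₁ := by rw [ha, hs]; have : 0 < γ * β * q₁ ^ k * q₁ := by positivity
                          linarith
  have heq : Wtilde W β γ q₁ (k + 1) - averagingMatrix n
      = a • (1 - averagingMatrix n) + (1 - a) • (W - averagingMatrix n) := by
    rw [Wtilde, hr]
    ext i j
    simp [ha]
    ring
  have hJ := specNorm_one_sub_averagingMatrix_le hW.pos
  rw [heq]
  calc specNorm (a • (1 - averagingMatrix n) + (1 - a) • (W - averagingMatrix n))
      ≤ a * specNorm (1 - averagingMatrix n) + (1 - a) * ρ := by
        unfold specNorm at *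
        rw [map_add, map_smul, map_smul]
        refine (norm_add_le _ _).trans ?_
        rw [norm_smul, norm_smul, Real.norm_of_nonneg ha0, Real.norm_of_nonneg (by linarith), hρ]
    _ ≤ q₁ + (1 - q₁) * ρ := by nlinarith

end Weights

/-! ### Frobenius norm, averages and deviations of stacked variables -/

section StackNorm

variable {n p : ℕ}

/-- The Frobenius norm on stacked variables. -/
noncomputable def stackNorm (s : Stack n p) : ℝ :=
  ‖(WithLp.toLp 2 s : PiLp 2 fun _ : Fin n => Vec p)‖

lemma stackNorm_nonneg (s : Stack n p) : 0 ≤ stackNorm s := norm_nonneg _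

lemma stackNorm_sq (s : Stack n p) : stackNorm s ^ 2 = ∑ i, ‖s i‖ ^ 2 :=
  PiLp.norm_sq_eq_of_L2 _ _

lemma stackNorm_add_le (s t : Stack n p) : stackNorm (s + t) ≤ stackNorm s + stackNorm t :=
  norm_add_le (WithLp.toLp 2 s : PiLp 2 fun _ : Fin n => Vec p) (WithLp.toLp 2 t)

lemma stackNorm_sub_le (s t : Stack n p) : stackNorm (s - t) ≤ stackNorm s + stackNorm t :=
  norm_sub_le (WithLp.toLp 2 s : PiLp 2 fun _ : Fin n => Vec p) (WithLp.toLp 2 t)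

lemma stackNorm_smul (c : ℝ) (s : Stack n p) : stackNorm (c • s) = |c| * stackNorm s :=
  norm_smul c (WithLp.toLp 2 s : PiLp 2 fun _ : Fin n => Vec p)

lemma norm_le_stackNorm (s : Stack n p) (i : Fin n) : ‖s i‖ ≤ stackNorm s :=
  PiLp.norm_apply_le (WithLp.toLp 2 s : PiLp 2 fun _ : Fin n => Vec p) i

lemma stackNorm_le_of_norm_le {s t : Stack n p} {c : ℝ} (hc : 0 ≤ c)
    (h : ∀ i, ‖s i‖ ≤ c * ‖t i‖) : stackNorm s ≤ c * stackNorm t := by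
  refine le_of_sq_le_sq ?_ (mul_nonneg hc (stackNorm_nonneg _))
  rw [mul_pow, stackNorm_sq, stackNorm_sq, Finset.mul_sum]
  refine Finset.sum_le_sum fun i _ => ?_
  rw [← mul_pow]
  exact pow_le_pow_left₀ (norm_nonneg _) (h i) 2

/-- The action of a weight matrix on stacked variables. -/
noncomputable def mulStack (M : Matrix (Fin n) (Fin n) ℝ) (s : Stack n p) : Stack n p :=
  fun i => ∑ j, M i j • s j

/-- The matrix acts separately on each of the `p` columns, so the vector estimate is summed over
columns. -/
lemma stackNorm_mulStack_le (M : Matrix (Fin n) (Fin n) ℝ) (s : Stack n p) :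
    stackNorm (mulStack M s) ≤ specNorm M * stackNorm s := by
  refine le_of_sq_le_sq ?_ (mul_nonneg (specNorm_nonneg _) (stackNorm_nonneg _))
  rw [mul_pow, stackNorm_sq, stackNorm_sq]
  simp_rw [EuclideanSpace.norm_sq_eq, Real.norm_eq_abs, sq_abs]
  rw [Finset.sum_comm, Finset.sum_comm (f := fun i j => s i j ^ 2), Finset.mul_sum]
  refine Finset.sum_le_sum fun c _ => ?_
  simpa [mulStack] using sum_mul_sq_le_specNorm M fun i => s i c

lemma norm_rowAvg_le (s : Stack n p) : ‖rowAvg s‖ ≤ stackNorm s := by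
  rcases Nat.eq_zero_or_pos n with rfl | hn
  · simpa [rowAvg] using stackNorm_nonneg s
  have hn' : (0 : ℝ) < n := by exact_mod_cast hn
  rw [rowAvg, norm_smul, Real.norm_of_nonneg (by positivity)]
  calc 1 / (n : ℝ) * ‖∑ i, s i‖ ≤ 1 / (n : ℝ) * ∑ _i : Fin n, stackNorm s := by
        gcongr
        exact (norm_sum_le _ _).trans (Finset.sum_le_sum fun i _ => norm_le_stackNorm s i)
    _ = stackNorm s := by simp; field_simp

/-- The deviation of the rows from their average. -/
noncomputable def deviation (s : Stack n p) : Stack n p := fun i => s i - rowAvg s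

lemma consensusErr_eq (s : Stack n p) : consensusErr s = stackNorm (deviation s) ^ 2 := by
  rw [stackNorm_sq]; rfl

lemma rowAvg_add (s t : Stack n p) : rowAvg (s + t) = rowAvg s + rowAvg t := by
  simp [rowAvg, Finset.sum_add_distrib]

lemma rowAvg_sub (s t : Stack n p) : rowAvg (s - t) = rowAvg s - rowAvg t := by
  simp [rowAvg, Finset.sum_sub_distrib, smul_sub]

lemma rowAvg_smul (c : ℝ) (s : Stack n p) : rowAvg (c • s) = c • rowAvg s := by
  simp [rowAvg, ← Finset.smul_sum, smul_comm c]

lemma rowAvg_mulStack {W : Matrix (Fin n) (Fin n) ℝ} (hW : IsWeightMatrix W) (s : Stack n p) :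
    rowAvg (mulStack W s) = rowAvg s := by
  simp only [rowAvg, mulStack]
  rw [Finset.sum_comm]
  simp_rw [← Finset.sum_smul, hW.col_sum, one_smul]

lemma deviation_add (s t : Stack n p) : deviation (s + t) = deviation s + deviation t := by
  ext1 i; simp [deviation, rowAvg_add]; abel

lemma deviation_sub (s t : Stack n p) : deviation (s - t) = deviation s - deviation t := by
  ext1 i; simp [deviation, rowAvg_sub]; abel

lemma deviation_smul (c : ℝ) (s : Stack n p) : deviation (c • s) = c • deviation s := by
  ext1 i; simp [deviation, rowAvg_smul, smul_sub]

lemma deviation_eq_mulStack (s : Stack n p) : deviation s = mulStack (1 - averagingMatrix n) s := by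
  ext1 i
  simp [deviation, mulStack, averagingMatrix, rowAvg, sub_smul, Finset.sum_sub_distrib,
    Matrix.one_apply, Finset.smul_sum]

lemma stackNorm_deviation_le (hn : 0 < n) (s : Stack n p) :
    stackNorm (deviation s) ≤ stackNorm s := by
  rw [deviation_eq_mulStack]
  refine (stackNorm_mulStack_le _ _).trans ?_
  exact mul_le_of_le_one_left (stackNorm_nonneg _) (specNorm_one_sub_averagingMatrix_le hn)

/-- Deviations sum to zero, so `J` annihilates them and may be subtracted from `W` freely; this
exposes the contraction factor. -/
lemma deviation_mulStack {W : Matrix (Fin n) (Fin n) ℝ} (hW : IsWeightMatrix W) (s : Stack n p) :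
    deviation (mulStack W s) = mulStack (W - averagingMatrix n) (deviation s) := by
  have h0 : ∑ j, deviation s j = 0 := by
    have hn : (n : ℝ) ≠ 0 := by have := hW.pos; positivity
    simp [deviation, Finset.sum_sub_distrib, rowAvg, ← Nat.cast_smul_eq_nsmul ℝ, smul_smul, hn]
  ext1 i
  have h1 : mulStack (W - averagingMatrix n) (deviation s) i = ∑ j, W i j • deviation s j := by
    simp only [mulStack, Matrix.sub_apply, sub_smul, Finset.sum_sub_distrib, averagingMatrix,
      Matrix.of_apply]
    rw [← Finset.smul_sum, h0, smul_zero, sub_zero]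
  rw [h1]
  simp only [deviation, rowAvg_mulStack hW, smul_sub, Finset.sum_sub_distrib, ← Finset.sum_smul,
    hW.row_sum, one_smul]
  rfl

lemma stackNorm_sub_mulStack_le {W : Matrix (Fin n) (Fin n) ℝ} (hW : IsWeightMatrix W)
    (s : Stack n p) : stackNorm (s - mulStack W s) ≤ 2 * stackNorm (deviation s) := by
  have h : s - mulStack W s = deviation s - mulStack (W - averagingMatrix n) (deviation s) := by
    rw [← deviation_mulStack hW]
    ext1 i
    simp [deviation, rowAvg_mulStack hW]
  rw [h]
  refine (stackNorm_sub_le _ _).trans ?_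
  have := stackNorm_mulStack_le (W - averagingMatrix n) (deviation s)
  have := mul_le_of_le_one_left (stackNorm_nonneg (deviation s))
    hW.specNorm_sub_averagingMatrix_lt.le
  linarith

end StackNorm

/-! ### Scalar recursions -/

section Sequences

/-- Discrete Gronwall inequality, from `1 + t ≤ exp t`. -/
lemma le_exp_sum_mul_of_le {M a b : ℕ → ℝ} {c : ℝ} (hc : 0 ≤ c) (ha : ∀ k, 0 ≤ a k)
    (hb : ∀ k, 0 ≤ b k) (hM0 : 0 ≤ M 0) (h : ∀ k, M (k + 1) ≤ (1 + c * a k) * M k + b k) (k : ℕ) :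
    M k ≤ Real.exp (c * ∑ m ∈ Finset.range k, a m) * (M 0 + ∑ m ∈ Finset.range k, b m) := by
  induction k with
  | zero => simp
  | succ k ih =>
    have h1 : 1 + c * a k ≤ Real.exp (c * a k) := by
      rw [add_comm]; exact Real.add_one_le_exp _
    have h2 : 0 ≤ M 0 + ∑ m ∈ Finset.range k, b m :=
      add_nonneg hM0 (Finset.sum_nonneg fun m _ => hb m)
    have h3 : 0 ≤ 1 + c * a k := by have := mul_nonneg hc (ha k); linarith
    have h4 : 1 ≤ Real.exp (c * ∑ m ∈ Finset.range (k + 1), a m) :=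
      Real.one_le_exp (mul_nonneg hc (Finset.sum_nonneg fun m _ => ha m))
    calc M (k + 1) ≤ (1 + c * a k) * M k + b k := h k
      _ ≤ Real.exp (c * a k) *
            (Real.exp (c * ∑ m ∈ Finset.range k, a m) * (M 0 + ∑ m ∈ Finset.range k, b m))
            + Real.exp (c * ∑ m ∈ Finset.range (k + 1), a m) * b k := by
          refine add_le_add ?_ (le_mul_of_one_le_left (hb k) h4)
          exact (mul_le_mul_of_nonneg_left ih h3).trans
            (mul_le_mul_of_nonneg_right h1 (by positivity))
      _ = _ := by
          rw [Finset.sum_range_succ, Finset.sum_range_succ, mul_add c, Real.exp_add]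
          ring

/-- Summing the recursion telescopes to `(1 - ρ) ∑ u + u N ≤ u 0 + ∑ b`. -/
lemma summable_of_le_mul_add {u b : ℕ → ℝ} {ρ : ℝ} (hρ : ρ < 1) (hu : ∀ k, 0 ≤ u k)
    (hb0 : ∀ k, 0 ≤ b k) (hb : Summable b) (h : ∀ k, u (k + 1) ≤ ρ * u k + b k) : Summable u := by
  refine summable_of_sum_range_le (c := (u 0 + ∑' k, b k) / (1 - ρ)) hu fun N => ?_
  rw [le_div_iff₀ (by linarith)]
  have h1 : ∀ N, (∑ k ∈ Finset.range N, u k) * (1 - ρ) + u N ≤ u 0 + ∑ k ∈ Finset.range N, b k := by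
    intro N
    induction N with
    | zero => simp
    | succ N ih =>
      rw [Finset.sum_range_succ, Finset.sum_range_succ]
      have := h N
      linarith
  have := h1 N
  have := hu N
  have := hb.sum_le_tsum (Finset.range N) fun k _ => hb0 k
  linarith

/-- The letters stand for consensus error `u`, dual norm `v`, optimization distance `w`, noise `s`,
stepsize `a` and gradient norm `g`. The dual variable grows by `2 β u` without a stepsize factor;
the weight `η` makes this cost `(1 - ρ) u`, exactly what the contraction of `u` gains. All remaining
growth carries the factor `a`. -/
lemma potential_step {u v w s a g u' v' w' γ β η ρ L G N : ℝ} (hu : 0 ≤ u) (hv : 0 ≤ v)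
    (hw : 0 ≤ w) (hs : 0 ≤ s) (ha : 0 ≤ a) (haγ : a ≤ γ) (hη : 0 < η) (hηβ : η * (2 * β) = 1 - ρ)
    (hβ : 0 ≤ β) (hL : 0 ≤ L) (hN : 0 ≤ N)
    (h1 : v' ≤ v + 2 * β * (u + s)) (h2 : u' ≤ ρ * (u + s) + a * (v' + g))
    (h3 : w' ≤ s + a * g + w) (h4 : g ≤ G + L * (u + s + N * w)) :
    u' + η * v' + w' ≤ (1 + (1 / η + 2 * β + 2 * L + 2 * L * N) * a) * (u + η * v + w)
      + ((2 + γ * (2 * β + 2 * L)) * s + 2 * G * a) := by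
  set m := u + η * v + w with hm
  have hηv : 0 ≤ η * v := by positivity
  have hum : u ≤ m := by linarith
  have hwm : w ≤ m := by linarith
  have hvm : v ≤ 1 / η * m := by
    rw [div_mul_eq_mul_div, one_mul, le_div_iff₀ hη]; linarith
  have e1 : u' + η * v' + w' ≤ m + 2 * s + a * (v' + 2 * g) := by
    have e2 : η * v' ≤ η * v + (1 - ρ) * (u + s) := by
      rw [← hηβ, mul_assoc, ← mul_add]
      exact mul_le_mul_of_nonneg_left h1 hη.le
    linarith
  have e3 : v' + 2 * g ≤ (1 / η + 2 * β + 2 * L + 2 * L * N) * m + (2 * β + 2 * L) * s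
      + 2 * G := by
    have e4 : 2 * β * u ≤ 2 * β * m := by gcongr
    have e5 : L * u ≤ L * m := by gcongr
    have e6 : L * N * w ≤ L * N * m := by gcongr
    linarith
  have e8 : a * ((2 * β + 2 * L) * s) ≤ γ * ((2 * β + 2 * L) * s) := by gcongr
  have e9 := mul_le_mul_of_nonneg_left e3 ha
  linarith

end Sequences

/-! ### Pathwise analysis of the algorithm -/

section Dynamics

variable {n p : ℕ} {f : Fin n → Vec p → ℝ} {L μ : ℝ} {W : Matrix (Fin n) (Fin n) ℝ}

/-- The stacked local gradients. -/
noncomputable def gradStack (f : Fin n → Vec p → ℝ) (z : Stack n p) : Stack n p :=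
  fun i => ∇ (f i) (z i)

lemma algStep_snd (f : Fin n → Vec p → ℝ) (W : Matrix (Fin n) (Fin n) ℝ) (β α : ℝ)
    (ξ x y : Stack n p) :
    (algStep f W β α ξ (x, y)).2 = y + β • ((x + ξ) - mulStack W (x + ξ)) := rfl

lemma algStep_fst (f : Fin n → Vec p → ℝ) (W : Matrix (Fin n) (Fin n) ℝ) (β α : ℝ)
    (ξ x y : Stack n p) :
    (algStep f W β α ξ (x, y)).1
      = mulStack W (x + ξ) - α • ((algStep f W β α ξ (x, y)).2 + gradStack f (x + ξ)) := rfl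

lemma rowAvg_algStep_snd (hW : IsWeightMatrix W) (β α : ℝ) (ξ x y : Stack n p) :
    rowAvg (algStep f W β α ξ (x, y)).2 = rowAvg y := by
  rw [algStep_snd, rowAvg_add, rowAvg_smul, rowAvg_sub, rowAvg_mulStack hW, sub_self, smul_zero,
    add_zero]

/-- Dual increments have average zero because `W` preserves averages, so the start `y = 0` removes
the dual variable from the averaged dynamics. -/
lemma rowAvg_algState_snd (hW : IsWeightMatrix W) (β : ℝ) (α : ℕ → ℝ) (x₀ : Stack n p)
    (ξ : ℕ → Stack n p) (k : ℕ) : rowAvg (algState f W β α x₀ ξ k).2 = 0 := by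
  induction k with
  | zero => simp [algState, rowAvg]
  | succ k ih => exact (rowAvg_algStep_snd hW _ _ _ _ _).trans ih

lemma rowAvg_algStep_fst (hW : IsWeightMatrix W) (β α : ℝ) (ξ x y : Stack n p)
    (hy : rowAvg y = 0) :
    rowAvg (algStep f W β α ξ (x, y)).1
      = rowAvg x + rowAvg ξ - α • rowAvg (gradStack f (x + ξ)) := by
  rw [algStep_fst, rowAvg_sub, rowAvg_smul, rowAvg_add, rowAvg_mulStack hW, rowAvg_add,
    rowAvg_algStep_snd hW, hy, zero_add]

lemma stackNorm_const_le (v : Vec p) : stackNorm (fun _ : Fin n => v) ≤ n * ‖v‖ := by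
  refine le_of_sq_le_sq ?_ (by positivity)
  rw [stackNorm_sq, mul_pow]
  simp only [Finset.sum_const, Finset.card_univ, Fintype.card_fin, nsmul_eq_mul]
  gcongr
  exact_mod_cast Nat.le_self_pow two_ne_zero n

lemma stackNorm_gradStack_le (hf : ∀ i, IsSmoothStronglyConvex L μ (f i)) (xstar : Vec p)
    (x ξ : Stack n p) :
    stackNorm (gradStack f (x + ξ)) ≤ stackNorm (gradStack f fun _ => xstar)
      + |L| * (stackNorm (deviation x) + stackNorm ξ + n * ‖rowAvg x - xstar‖) := by
  have h1 : gradStack f (x + ξ) = (gradStack f fun _ => xstar)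
      + (gradStack f (x + ξ) - gradStack f fun _ => xstar) := by abel
  have h2 : stackNorm (gradStack f (x + ξ) - gradStack f fun _ => xstar)
      ≤ |L| * stackNorm ((x + ξ) - fun _ => xstar) := by
    refine stackNorm_le_of_norm_le (abs_nonneg _) fun i => ?_
    exact ((hf i).smooth _ _).trans (mul_le_mul_of_nonneg_right (le_abs_self L) (norm_nonneg _))
  have h3 : ((x + ξ) - fun _ => xstar) = deviation x + ξ + fun _ => rowAvg x - xstar := by
    ext1 i; simp [deviation]; abel
  rw [h1]
  refine (stackNorm_add_le _ _).trans (add_le_add le_rfl (h2.trans ?_))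
  rw [h3]
  refine mul_le_mul_of_nonneg_left ?_ (abs_nonneg _)
  refine (stackNorm_add_le _ _).trans (add_le_add (stackNorm_add_le _ _) ?_)
  exact stackNorm_const_le _

lemma stackNorm_deviation_add_le (hn : 0 < n) (x ξ : Stack n p) :
    stackNorm (deviation (x + ξ)) ≤ stackNorm (deviation x) + stackNorm ξ := by
  rw [deviation_add]
  exact (stackNorm_add_le _ _).trans (add_le_add le_rfl (stackNorm_deviation_le hn _))

lemma stackNorm_algStep_snd_le (hW : IsWeightMatrix W) {β : ℝ} (hβ : 0 ≤ β) (α : ℝ)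
    (ξ x y : Stack n p) :
    stackNorm (algStep f W β α ξ (x, y)).2
      ≤ stackNorm y + 2 * β * (stackNorm (deviation x) + stackNorm ξ) := by
  rw [algStep_snd]
  refine (stackNorm_add_le _ _).trans (add_le_add le_rfl ?_)
  rw [stackNorm_smul, abs_of_nonneg hβ, mul_comm 2 β, mul_assoc]
  refine mul_le_mul_of_nonneg_left ?_ hβ
  refine (stackNorm_sub_mulStack_le hW _).trans ?_
  exact mul_le_mul_of_nonneg_left (stackNorm_deviation_add_le hW.pos _ _) zero_le_two

lemma stackNorm_deviation_algStep_fst_le (hW : IsWeightMatrix W) (β : ℝ) {α : ℝ} (hα : 0 ≤ α)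
    (ξ x y : Stack n p) :
    stackNorm (deviation (algStep f W β α ξ (x, y)).1)
      ≤ specNorm (W - averagingMatrix n) * (stackNorm (deviation x) + stackNorm ξ)
        + α * (stackNorm (algStep f W β α ξ (x, y)).2 + stackNorm (gradStack f (x + ξ))) := by
  rw [algStep_fst, deviation_sub, deviation_mulStack hW]
  refine (stackNorm_sub_le _ _).trans (add_le_add ?_ ?_)
  · refine (stackNorm_mulStack_le _ _).trans ?_
    exact mul_le_mul_of_nonneg_left (stackNorm_deviation_add_le hW.pos _ _) (specNorm_nonneg _)
  · rw [deviation_smul, stackNorm_smul, abs_of_nonneg hα]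
    refine mul_le_mul_of_nonneg_left ?_ hα
    exact (stackNorm_deviation_le hW.pos _).trans (stackNorm_add_le _ _)

lemma norm_rowAvg_algStep_sub_le (hW : IsWeightMatrix W) (β : ℝ) {α : ℝ} (hα : 0 ≤ α)
    (ξ x y : Stack n p) (hy : rowAvg y = 0) :
    ‖rowAvg (algStep f W β α ξ (x, y)).1 - rowAvg x‖
      ≤ stackNorm ξ + α * stackNorm (gradStack f (x + ξ)) := by
  rw [rowAvg_algStep_fst hW _ _ _ _ _ hy]
  have : rowAvg x + rowAvg ξ - α • rowAvg (gradStack f (x + ξ)) - rowAvg x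
      = rowAvg ξ - α • rowAvg (gradStack f (x + ξ)) := by abel
  rw [this]
  refine (norm_sub_le _ _).trans (add_le_add (norm_rowAvg_le _) ?_)
  rw [norm_smul, Real.norm_of_nonneg hα]
  exact mul_le_mul_of_nonneg_left (norm_rowAvg_le _) hα

/-- A weighted sum of the consensus error, the size of the dual variable and the optimization error,
with a recursion whose growth is governed by the stepsizes. -/
lemma exists_potential_recursion (hf : ∀ i, IsSmoothStronglyConvex L μ (f i)) (xstar : Vec p)
    (hW : IsWeightMatrix W) {β γ : ℝ} (hβ : 0 < β) {α : ℕ → ℝ} (hα : ∀ k, 0 ≤ α (k + 1))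
    (hαγ : ∀ k, α (k + 1) ≤ γ) (x₀ : Stack n p) :
    ∃ η : ℝ, 0 < η ∧ ∃ C : ℝ, 0 ≤ C ∧ ∀ (ξ : ℕ → Stack n p) (M : ℕ → ℝ),
      (∀ k, M k = stackNorm (deviation (algState f W β α x₀ ξ k).1)
        + η * stackNorm (algState f W β α x₀ ξ k).2
        + ‖rowAvg (algState f W β α x₀ ξ k).1 - xstar‖) →
      ∀ k, M (k + 1) ≤ (1 + C * α (k + 1)) * M k + C * (stackNorm (ξ (k + 1)) + α (k + 1)) := by
  have hρ1 := hW.specNorm_sub_averagingMatrix_lt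
  have hγ : 0 ≤ γ := (hα 0).trans (hαγ 0)
  obtain ⟨η, hη⟩ : ∃ η, η = (1 - specNorm (W - averagingMatrix n)) / (2 * β) := ⟨_, rfl⟩
  have hη0 : 0 < η := by rw [hη]; apply div_pos <;> linarith
  have hηβ : η * (2 * β) = 1 - specNorm (W - averagingMatrix n) := by rw [hη]; field_simp
  have hG0 : 0 ≤ stackNorm (gradStack f fun _ => xstar) := stackNorm_nonneg _
  obtain ⟨C₁, hC₁⟩ : ∃ C₁, C₁ = 1 / η + 2 * β + 2 * |L| + 2 * |L| * n := ⟨_, rfl⟩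
  obtain ⟨C₂, hC₂⟩ : ∃ C₂, C₂ = 2 + γ * (2 * β + 2 * |L|) := ⟨_, rfl⟩
  have hC₁0 : 0 ≤ C₁ := by rw [hC₁]; positivity
  have hC₂0 : 0 ≤ C₂ := by rw [hC₂]; positivity
  refine ⟨η, hη0, C₁ + C₂ + 2 * stackNorm (gradStack f fun _ => xstar), by positivity,
    fun ξ M hM k => ?_⟩
  have hM0 : 0 ≤ M k := by
    rw [hM]
    exact add_nonneg (add_nonneg (stackNorm_nonneg _) (mul_nonneg hη0.le (stackNorm_nonneg _)))
      (norm_nonneg _)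
  have hs : 0 ≤ stackNorm (ξ (k + 1)) := stackNorm_nonneg _
  have ha := hα k
  have key : M (k + 1) ≤ (1 + C₁ * α (k + 1)) * M k + (C₂ * stackNorm (ξ (k + 1))
      + 2 * stackNorm (gradStack f fun _ => xstar) * α (k + 1)) := by
    have hy := rowAvg_algState_snd (f := f) hW β α x₀ ξ k
    rw [hM, hM, hC₁, hC₂]
    simp only [algState]
    generalize algState f W β α x₀ ξ k = s at hy
    obtain ⟨x, y⟩ := s
    have h5 := norm_sub_le_norm_sub_add_norm_sub
      (rowAvg (algStep f W β (α (k + 1)) (ξ (k + 1)) (x, y)).1) (rowAvg x) xstar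
    exact potential_step (stackNorm_nonneg _) (stackNorm_nonneg _) (norm_nonneg _) hs ha (hαγ k)
      hη0 hηβ hβ.le (abs_nonneg L) (Nat.cast_nonneg n)
      (stackNorm_algStep_snd_le hW hβ.le _ _ _ _)
      (stackNorm_deviation_algStep_fst_le hW β ha _ _ _)
      (h5.trans (add_le_add (norm_rowAvg_algStep_sub_le hW β ha _ _ _ hy) le_rfl))
      (stackNorm_gradStack_le hf xstar _ _)
  refine key.trans ?_
  generalize stackNorm (gradStack f fun _ => xstar) = G at hG0
  generalize stackNorm (ξ (k + 1)) = s at hs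
  generalize α (k + 1) = a at ha
  have e1 : 0 ≤ (C₂ + 2 * G) * a * M k := by positivity
  have e2 : 0 ≤ (C₁ + 2 * G) * s := by positivity
  have e3 : 0 ≤ (C₁ + C₂) * a := by positivity
  linarith

/-- Along summable noise the states stay within a bound that is affine in the total noise. -/
lemma exists_algState_bound (hf : ∀ i, IsSmoothStronglyConvex L μ (f i)) (xstar : Vec p)
    (hW : IsWeightMatrix W) {β γ : ℝ} (hβ : 0 < β) {α : ℕ → ℝ} (hα : ∀ k, 0 ≤ α (k + 1))
    (hαγ : ∀ k, α (k + 1) ≤ γ) (hαs : Summable fun k => α (k + 1)) (x₀ : Stack n p) :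
    ∃ K : ℝ, 0 < K ∧ ∀ ξ : ℕ → Stack n p, (Summable fun k => stackNorm (ξ (k + 1))) → ∀ k,
      stackNorm (deviation (algState f W β α x₀ ξ k).1)
          ≤ K * (1 + ∑' m, stackNorm (ξ (m + 1))) ∧
      stackNorm (algState f W β α x₀ ξ k).2 ≤ K * (1 + ∑' m, stackNorm (ξ (m + 1))) ∧
      ‖rowAvg (algState f W β α x₀ ξ k).1 - xstar‖ ≤ K * (1 + ∑' m, stackNorm (ξ (m + 1))) := by
  obtain ⟨η, hη0, C, hC0, hrec⟩ := exists_potential_recursion hf xstar hW hβ hα hαγ x₀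
  obtain ⟨A, hA⟩ : ∃ A, A = ∑' k, α (k + 1) := ⟨_, rfl⟩
  have hA0 : 0 ≤ A := hA ▸ tsum_nonneg hα
  obtain ⟨M₀, hM₀⟩ : ∃ M₀, M₀ = stackNorm (deviation x₀) + ‖rowAvg x₀ - xstar‖ := ⟨_, rfl⟩
  have hM₀0 : 0 ≤ M₀ := hM₀ ▸ add_nonneg (stackNorm_nonneg _) (norm_nonneg _)
  obtain ⟨B, hB⟩ : ∃ B, B = Real.exp (C * A) * (M₀ + C * A + C + 1) := ⟨_, rfl⟩
  have hB0 : 0 < B := hB ▸ by positivity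
  -- `B` bounds the potential; the extra `1 / η` undoes the weight of the dual variable.
  refine ⟨B * (1 + 1 / η), by positivity, fun ξ hξ k => ?_⟩
  have hS0 : 0 ≤ ∑' m, stackNorm (ξ (m + 1)) := tsum_nonneg fun _ => stackNorm_nonneg _
  have hsa : ∑ m ∈ Finset.range k, α (m + 1) ≤ A := hA ▸ hαs.sum_le_tsum _ fun m _ => hα m
  have hss : ∑ m ∈ Finset.range k, stackNorm (ξ (m + 1)) ≤ ∑' m, stackNorm (ξ (m + 1)) :=
    hξ.sum_le_tsum _ fun m _ => stackNorm_nonneg _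
  obtain ⟨M, hM⟩ : ∃ M : ℕ → ℝ, ∀ k, M k = stackNorm (deviation (algState f W β α x₀ ξ k).1)
        + η * stackNorm (algState f W β α x₀ ξ k).2
        + ‖rowAvg (algState f W β α x₀ ξ k).1 - xstar‖ := ⟨_, fun _ => rfl⟩
  have hM00 : M 0 = M₀ := by
    have : stackNorm (0 : Stack n p) = 0 := norm_zero (E := PiLp 2 fun _ : Fin n => Vec p)
    simp [hM, algState, this, hM₀]
  have h : M k ≤ B * (1 + ∑' m, stackNorm (ξ (m + 1))) := by
    refine (le_exp_sum_mul_of_le (b := fun k => C * (stackNorm (ξ (k + 1)) + α (k + 1))) hC0 hα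
      (fun k => mul_nonneg hC0 (add_nonneg (stackNorm_nonneg _) (hα k))) (hM00 ▸ hM₀0)
      (hrec ξ M hM) k).trans ?_
    rw [hM00, ← Finset.mul_sum, Finset.sum_add_distrib, hB]
    generalize ∑' m, stackNorm (ξ (m + 1)) = S at hS0 hss
    have hss0 : 0 ≤ ∑ m ∈ Finset.range k, stackNorm (ξ (m + 1)) :=
      Finset.sum_nonneg fun _ _ => stackNorm_nonneg _
    have hsa0 : 0 ≤ ∑ m ∈ Finset.range k, α (m + 1) := Finset.sum_nonneg fun m _ => hα m
    generalize ∑ m ∈ Finset.range k, stackNorm (ξ (m + 1)) = s at hss hss0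
    generalize ∑ m ∈ Finset.range k, α (m + 1) = a at hsa hsa0
    have t1 : C * s ≤ C * S := by gcongr
    have t2 : C * a ≤ C * A := by gcongr
    have t3 : 0 ≤ (M₀ + C * A + 1) * S := by positivity
    have t4 : M₀ + C * (s + a) ≤ (M₀ + C * A + C + 1) * (1 + S) := by linarith
    rw [mul_assoc (Real.exp (C * A))]
    exact mul_le_mul (Real.exp_le_exp.2 t2) t4 (by positivity) (Real.exp_pos _).le
  rw [hM] at h
  have hu := stackNorm_nonneg (deviation (algState f W β α x₀ ξ k).1)
  have hv := stackNorm_nonneg (algState f W β α x₀ ξ k).2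
  have hw := norm_nonneg (rowAvg (algState f W β α x₀ ξ k).1 - xstar)
  have hηv := mul_nonneg hη0.le hv
  generalize ∑' m, stackNorm (ξ (m + 1)) = S at *
  have h0 : 0 ≤ B * (1 + S) := by positivity
  have h1 : B * (1 + 1 / η) * (1 + S) = B * (1 + S) + 1 / η * (B * (1 + S)) := by ring
  have h2 : 0 ≤ 1 / η * (B * (1 + S)) := by positivity
  rw [h1]
  refine ⟨by linarith, ?_, by linarith⟩
  have h3 : stackNorm (algState f W β α x₀ ξ k).2 ≤ 1 / η * (B * (1 + S)) := by
    rw [div_mul_eq_mul_div, one_mul, le_div_iff₀ hη0]; linarith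
  linarith

/-- Along summable noise the agents reach consensus and their average converges. -/
lemma algState_tendsto (hf : ∀ i, IsSmoothStronglyConvex L μ (f i)) (hW : IsWeightMatrix W) {β : ℝ}
    (hβ : 0 < β) {α : ℕ → ℝ} (hα : ∀ k, 0 ≤ α (k + 1)) (hαs : Summable fun k => α (k + 1))
    (x₀ : Stack n p) {ξ : ℕ → Stack n p} (hξ : Summable fun k => stackNorm (ξ (k + 1))) :
    Tendsto (fun k => consensusErr (algState f W β α x₀ ξ k).1) atTop (𝓝 0) ∧
    ∃ v, Tendsto (fun k => rowAvg (algState f W β α x₀ ξ k).1) atTop (𝓝 v) := by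
  -- The total of the stepsizes serves as their upper bound, and the origin replaces the minimizer:
  -- boundedness needs only some reference point.
  have hαγ : ∀ k, α (k + 1) ≤ ∑' k, α (k + 1) := fun k => hαs.le_tsum k fun j _ => hα j
  obtain ⟨K, hK, hb⟩ := exists_algState_bound hf 0 hW hβ hα hαγ hαs x₀
  specialize hb ξ hξ
  set S := ∑' m, stackNorm (ξ (m + 1)) with hS
  have hS0 : 0 ≤ S := tsum_nonneg fun _ => stackNorm_nonneg _
  have hsS : ∀ k, stackNorm (ξ (k + 1)) ≤ S := fun k =>
    hξ.le_tsum k fun j _ => stackNorm_nonneg _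
  set G := stackNorm (gradStack f fun _ => (0 : Vec p))
  set D := G + |L| * (K * (1 + S) + S + n * (K * (1 + S))) with hD
  have hg : ∀ k, stackNorm (gradStack f ((algState f W β α x₀ ξ k).1 + ξ (k + 1))) ≤ D := by
    intro k
    refine (stackNorm_gradStack_le hf 0 _ _).trans ?_
    rw [hD]
    obtain ⟨h1, -, h2⟩ := hb k
    have := hsS k
    gcongr
  constructor
  · have hu : Summable fun k => stackNorm (deviation (algState f W β α x₀ ξ k).1) := by
      refine summable_of_le_mul_add (ρ := specNorm (W - averagingMatrix n))
        (b := fun k => stackNorm (ξ (k + 1)) + α (k + 1) * (K * (1 + S) + D))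
        hW.specNorm_sub_averagingMatrix_lt (fun _ => stackNorm_nonneg _) (fun k => ?_)
        (hξ.add (hαs.mul_right _)) fun k => ?_
      · have : 0 ≤ D := (stackNorm_nonneg _).trans (hg k)
        exact add_nonneg (stackNorm_nonneg _) (mul_nonneg (hα k) (by positivity))
      · refine (stackNorm_deviation_algStep_fst_le hW β (hα k) _ _ _).trans ?_
        have h1 := (hb (k + 1)).2.1
        have h2 : α (k + 1) * (stackNorm (algState f W β α x₀ ξ (k + 1)).2
            + stackNorm (gradStack f ((algState f W β α x₀ ξ k).1 + ξ (k + 1))))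
            ≤ α (k + 1) * (K * (1 + S) + D) :=
          mul_le_mul_of_nonneg_left (add_le_add h1 (hg k)) (hα k)
        have h3 : specNorm (W - averagingMatrix n) * stackNorm (ξ (k + 1))
            ≤ stackNorm (ξ (k + 1)) := mul_le_of_le_one_left (stackNorm_nonneg _)
              hW.specNorm_sub_averagingMatrix_lt.le
        rw [mul_add]
        simp only [algState] at h2
        linarith
    have h := (hu.tendsto_atTop_zero).pow 2
    simp_rw [consensusErr_eq]
    simpa using h
  · refine cauchySeq_tendsto_of_complete (cauchySeq_of_dist_le_of_summable
      (fun k => stackNorm (ξ (k + 1)) + α (k + 1) * D) (fun k => ?_) (hξ.add (hαs.mul_right _)))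
    rw [dist_comm, dist_eq_norm]
    refine (norm_rowAvg_algStep_sub_le hW β (hα k) _ _ _
      (rowAvg_algState_snd hW β α x₀ ξ k)).trans ?_
    exact add_le_add le_rfl (mul_le_mul_of_nonneg_left (hg k) (hα k))

end Dynamics

/-! ### Smooth strongly convex functions -/

section Convex

variable {p : ℕ} {L μ : ℝ} {g : Vec p → ℝ}

/-- The descent lemma. -/
lemma IsSmoothStronglyConvex.le_add (hg : IsSmoothStronglyConvex L μ g) (x v : Vec p) :
    g (x + v) ≤ g x + inner ℝ (∇ g x) v + L / 2 * ‖v‖ ^ 2 := by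
  -- The claim compares the values of `φ` at 0 and 1; smoothness makes its derivative nonpositive in
  -- between.
  set φ : ℝ → ℝ := fun t => g (x + t • v) - t * inner ℝ (∇ g x) v - L / 2 * t ^ 2 * ‖v‖ ^ 2
    with hφ
  have hd : ∀ t, HasDerivAt φ (inner ℝ (∇ g (x + t • v)) v - inner ℝ (∇ g x) v
      - L * t * ‖v‖ ^ 2) t := by
    intro t
    have h1 : HasDerivAt (fun t : ℝ => x + t • v) v t := by
      simpa using ((hasDerivAt_id t).smul_const v).const_add x
    have h2 : HasDerivAt (fun t : ℝ => g (x + t • v)) (inner ℝ (∇ g (x + t • v)) v) t := by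
      have := ((hg.differentiable (x + t • v)).hasFDerivAt).comp_hasDerivAt t h1
      rw [inner_gradient_left]
      exact this
    have h3 := (h2.sub ((hasDerivAt_id t).mul_const (inner ℝ (∇ g x) v))).sub
      ((((hasDerivAt_id t).pow 2).const_mul (L / 2)).mul_const (‖v‖ ^ 2))
    refine h3.congr_deriv ?_
    simp only [id, Nat.cast_ofNat]
    ring
  have hanti : AntitoneOn φ (Set.Icc 0 1) := by
    refine antitoneOn_of_deriv_nonpos (convex_Icc 0 1)
      (fun t _ => (hd t).continuousAt.continuousWithinAt)
      (fun t _ => (hd t).differentiableAt.differentiableWithinAt) fun t ht => ?_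
    rw [interior_Icc] at ht
    rw [(hd t).deriv, ← inner_sub_left]
    have h1 := real_inner_le_norm (∇ g (x + t • v) - ∇ g x) v
    have h2 := hg.smooth (x + t • v) x
    rw [add_sub_cancel_left, norm_smul, Real.norm_of_nonneg ht.1.le] at h2
    have h3 := mul_le_mul_of_nonneg_right h2 (norm_nonneg v)
    linarith
  have h := hanti (Set.left_mem_Icc.2 zero_le_one) (Set.right_mem_Icc.2 zero_le_one) zero_le_one
  simp [hφ, -inner_gradient_left] at h
  linarith

lemma IsSmoothStronglyConvex.inner_ge (hg : IsSmoothStronglyConvex L μ g) (x y : Vec p) :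
    μ * ‖x - y‖ ^ 2 ≤ inner ℝ (∇ g x - ∇ g y) (x - y) := by
  have h1 := hg.strongly_convex x y
  have h2 := hg.strongly_convex y x
  rw [norm_sub_rev] at h1
  have : inner ℝ (∇ g x) (y - x) = - inner ℝ (∇ g x) (x - y) := by
    rw [← inner_neg_right, neg_sub]
  rw [inner_sub_left]
  linarith

lemma IsSmoothStronglyConvex.le_of_ne (hg : IsSmoothStronglyConvex L μ g) {x y : Vec p}
    (hxy : x ≠ y) : μ ≤ L := by
  have h1 := hg.inner_ge x y
  have h2 := real_inner_le_norm (∇ g x - ∇ g y) (x - y)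
  have h3 := mul_le_mul_of_nonneg_right (hg.smooth x y) (norm_nonneg (x - y))
  have h4 : 0 < ‖x - y‖ ^ 2 := by
    have := norm_pos_iff.2 (sub_ne_zero.2 hxy); positivity
  nlinarith

/-- Interpolation inequality: one half of the co-coercivity estimate. -/
lemma IsSmoothStronglyConvex.half_cocoercive (hg : IsSmoothStronglyConvex L μ g) (x y : Vec p)
    (t : ℝ) :
    g x + inner ℝ (∇ g x) (y - x) + μ / 2 * ‖y - x‖ ^ 2
      + (t - (L - μ) * t ^ 2 / 2) * ‖∇ g y - ∇ g x - μ • (y - x)‖ ^ 2 ≤ g y := by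
  -- The point `y - t D` is bounded above by the descent lemma at `y` and below by strong convexity
  -- at `x`; `t` stays free so that the case `L = μ` is covered too.
  set D := ∇ g y - ∇ g x - μ • (y - x) with hD
  have h1 := hg.le_add y (-(t • D))
  have h2 := hg.strongly_convex x (y + -(t • D))
  have h3 : y + -(t • D) - x = (y - x) + -(t • D) := by abel
  rw [h3, norm_add_sq_real, inner_add_right] at h2
  rw [norm_neg, norm_smul, mul_pow, Real.norm_eq_abs, sq_abs] at h1 h2
  simp only [inner_neg_right, inner_smul_right] at h1 h2
  have h4 : inner ℝ (∇ g y) D - inner ℝ (∇ g x) D - μ * inner ℝ (y - x) D = ‖D‖ ^ 2 := by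
    rw [← real_inner_self_eq_norm_sq]
    rw [← inner_sub_left, ← real_inner_smul_left, ← inner_sub_left]
  have h5 : t * (inner ℝ (∇ g y) D - inner ℝ (∇ g x) D - μ * inner ℝ (y - x) D)
      = t * ‖D‖ ^ 2 := by rw [h4]
  linarith

lemma IsSmoothStronglyConvex.cocoercive_mul (hg : IsSmoothStronglyConvex L μ g) (x y : Vec p)
    (t : ℝ) :
    (2 * t - (L - μ) * t ^ 2) * ‖∇ g x - ∇ g y - μ • (x - y)‖ ^ 2
      ≤ inner ℝ (∇ g x - ∇ g y) (x - y) - μ * ‖x - y‖ ^ 2 := by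
  have h1 := hg.half_cocoercive x y t
  have h2 := hg.half_cocoercive y x t
  have e1 : ‖∇ g y - ∇ g x - μ • (y - x)‖ = ‖∇ g x - ∇ g y - μ • (x - y)‖ := by
    rw [← norm_neg]; congr 1; rw [smul_sub, smul_sub]; abel
  have e2 : inner ℝ (∇ g x) (y - x) = - inner ℝ (∇ g x) (x - y) := by
    rw [← inner_neg_right, neg_sub]
  rw [e1, e2, norm_sub_rev y x] at h1
  rw [inner_sub_left]
  linarith

/-- For `μ < L` the optimal parameter is `t = 1 / (L - μ)`. For `μ = L` the coefficient is `2 t`,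
unbounded in `t`, which forces the left side to vanish. -/
lemma IsSmoothStronglyConvex.cocoercive (hg : IsSmoothStronglyConvex L μ g) (hμL : μ ≤ L)
    (x y : Vec p) :
    ‖∇ g x - ∇ g y - μ • (x - y)‖ ^ 2
      ≤ (L - μ) * (inner ℝ (∇ g x - ∇ g y) (x - y) - μ * ‖x - y‖ ^ 2) := by
  rcases hμL.eq_or_lt with h | h
  · subst h
    have h1 := hg.inner_ge x y
    set D := ‖∇ g x - ∇ g y - μ • (x - y)‖ ^ 2 with hD
    set I := inner ℝ (∇ g x - ∇ g y) (x - y) - μ * ‖x - y‖ ^ 2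
    have h2 : ∀ t : ℝ, 2 * t * D ≤ I := fun t => by
      simpa using hg.cocoercive_mul x y t
    simp only [sub_self, zero_mul]
    by_contra hD0
    push Not at hD0
    have h3 := h2 ((I + 1) / D)
    have : 2 * ((I + 1) / D) * D = 2 * (I + 1) := by field_simp
    have h4 : 0 ≤ I := by simp only [I]; linarith
    linarith
  · have h1 := hg.cocoercive_mul x y (1 / (L - μ))
    have h2 : 0 < L - μ := by linarith
    have h3 : 2 * (1 / (L - μ)) - (L - μ) * (1 / (L - μ)) ^ 2 = 1 / (L - μ) := by
      field_simp; ring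
    rw [h3, div_mul_eq_mul_div, one_mul, div_le_iff₀ h2] at h1
    linarith

/-- A gradient step with a small stepsize contracts distances. -/
lemma IsSmoothStronglyConvex.norm_gradientStep_sub_le (hg : IsSmoothStronglyConvex L μ g)
    (hμ : 0 < μ) (hμL : μ ≤ L) {α : ℝ} (hα : 0 ≤ α) (hα' : α ≤ 2 / (μ + L)) (x y : Vec p) :
    ‖x - y - α • (∇ g x - ∇ g y)‖ ≤ (1 - α * μ) * ‖x - y‖ := by
  have hμL0 : 0 < μ + L := by linarith
  have hα2 : α * (μ + L) ≤ 2 := (le_div_iff₀ hμL0).1 hα'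
  have h1 : 0 ≤ 1 - α * μ := by nlinarith
  refine le_of_sq_le_sq ?_ (mul_nonneg h1 (norm_nonneg _))
  have hc := hg.cocoercive hμL x y
  have hm := hg.inner_ge x y
  set e := x - y
  set F := ∇ g x - ∇ g y
  have e1 : ‖e - α • F‖ ^ 2 = ‖e‖ ^ 2 - 2 * α * inner ℝ F e + α ^ 2 * ‖F‖ ^ 2 := by
    rw [norm_sub_sq_real, inner_smul_right, norm_smul, mul_pow, Real.norm_eq_abs, sq_abs,
      real_inner_comm]
    ring
  have e2 : ‖F - μ • e‖ ^ 2 = ‖F‖ ^ 2 - 2 * μ * inner ℝ F e + μ ^ 2 * ‖e‖ ^ 2 := by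
    rw [norm_sub_sq_real, inner_smul_right, norm_smul, mul_pow, Real.norm_eq_abs, sq_abs]
    ring
  rw [e2] at hc
  rw [e1]
  have h2 := mul_le_mul_of_nonneg_left hc (sq_nonneg α)
  -- This is the slack left after co-coercivity; its sign is where `α ≤ 2 / (μ + L)` enters
  -- decisively.
  have h3 : 0 ≤ α * (2 - α * (μ + L)) * (inner ℝ F e - μ * ‖e‖ ^ 2) :=
    mul_nonneg (mul_nonneg hα (by linarith)) (by linarith)
  linarith

lemma IsSmoothStronglyConvex.continuous_gradient (hg : IsSmoothStronglyConvex L μ g) :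
    Continuous (∇ g) := by
  refine (LipschitzWith.of_dist_le_mul (K := ⟨|L|, abs_nonneg L⟩) fun x y => ?_).continuous
  rw [dist_eq_norm, dist_eq_norm]
  exact (hg.smooth x y).trans (mul_le_mul_of_nonneg_right (le_abs_self L) (norm_nonneg _))

variable {n : ℕ} {f : Fin n → Vec p → ℝ}

lemma hasGradientAt_globalCost (hf : ∀ i, Differentiable ℝ (f i)) (x : Vec p) :
    HasGradientAt (globalCost f) (rowAvg fun i => ∇ (f i) x) x := by
  rw [hasGradientAt_iff_hasFDerivAt]
  have h := (HasFDerivAt.fun_sum fun i (_ : i ∈ Finset.univ) =>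
    (hf i x).hasGradientAt.hasFDerivAt).const_mul (1 / (n : ℝ))
  refine h.congr_fderiv ?_
  simp [rowAvg]

lemma norm_rowAvg_le_sum (s : Stack n p) : ‖rowAvg s‖ ≤ 1 / (n : ℝ) * ∑ i, ‖s i‖ := by
  rw [rowAvg, norm_smul, Real.norm_of_nonneg (by positivity)]
  exact mul_le_mul_of_nonneg_left (norm_sum_le _ _) (by positivity)

lemma inner_rowAvg_left (s : Stack n p) (v : Vec p) :
    inner ℝ (rowAvg s) v = 1 / (n : ℝ) * ∑ i, inner ℝ (s i) v := by
  rw [rowAvg, inner_smul_left, sum_inner]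
  simp

lemma isSmoothStronglyConvex_globalCost (hn : 0 < n)
    (hf : ∀ i, IsSmoothStronglyConvex L μ (f i)) :
    IsSmoothStronglyConvex L μ (globalCost f) where
  differentiable x :=
    (hasGradientAt_globalCost (fun i => (hf i).differentiable) x).differentiableAt
  smooth x y := by
    rw [(hasGradientAt_globalCost (fun i => (hf i).differentiable) x).gradient,
      (hasGradientAt_globalCost (fun i => (hf i).differentiable) y).gradient, ← rowAvg_sub]
    refine (norm_rowAvg_le_sum _).trans ?_
    have hn' : (0 : ℝ) < n := by exact_mod_cast hn
    calc 1 / (n : ℝ) * ∑ i, ‖∇ (f i) x - ∇ (f i) y‖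
        ≤ 1 / (n : ℝ) * ∑ _i : Fin n, L * ‖x - y‖ := by
          gcongr with i
          exact (hf i).smooth x y
      _ = L * ‖x - y‖ := by simp; field_simp
  strongly_convex x y := by
    rw [(hasGradientAt_globalCost (fun i => (hf i).differentiable) x).gradient,
      inner_rowAvg_left]
    have hn' : (0 : ℝ) < n := by exact_mod_cast hn
    have h : μ / 2 * ‖y - x‖ ^ 2 = 1 / (n : ℝ) * ∑ _i : Fin n, μ / 2 * ‖y - x‖ ^ 2 := by
      simp; field_simp
    rw [h]
    simp only [globalCost]
    rw [← mul_add, ← mul_add, ← Finset.sum_add_distrib, ← Finset.sum_add_distrib]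
    gcongr with i
    exact (hf i).strongly_convex x y

lemma gradient_globalCost_eq_zero {xstar : Vec p}
    (hx : ∀ x, globalCost f xstar ≤ globalCost f x) : ∇ (globalCost f) xstar = 0 := by
  have h : IsLocalMin (globalCost f) xstar := Filter.Eventually.of_forall hx
  rw [gradient, h.fderiv_eq_zero, map_zero]

end Convex

/-! ### Moments of the Laplace distribution -/

section Laplace

lemma integral_laplaceMeasure {c : ℝ} (hc : 0 < c) (g : ℝ → ℝ) :
    ∫ t, g t ∂laplaceMeasure c = ∫ t, 1 / (2 * c) * Real.exp (-|t| / c) * g t := by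
  rw [laplaceMeasure, integral_withDensity_eq_integral_toReal_smul (by fun_prop)
    (ae_of_all _ fun _ => ENNReal.ofReal_lt_top)]
  refine integral_congr_ae (ae_of_all _ fun t => ?_)
  simp only [smul_eq_mul]
  rw [ENNReal.toReal_ofReal (by positivity)]

lemma integral_id_laplaceMeasure {c : ℝ} (hc : 0 < c) : ∫ t, t ∂laplaceMeasure c = 0 := by
  rw [integral_laplaceMeasure hc fun t => t]
  have h := integral_neg_eq_self (fun t : ℝ => 1 / (2 * c) * Real.exp (-|t| / c) * t) volume
  simp only [abs_neg, mul_neg, integral_neg] at h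
  linarith

lemma integral_sq_laplaceMeasure {c : ℝ} (hc : 0 < c) :
    ∫ t, t ^ 2 ∂laplaceMeasure c = 2 * c ^ 2 := by
  rw [integral_laplaceMeasure hc fun t => t ^ 2]
  have h1 := integral_comp_abs (f := fun t : ℝ => 1 / (2 * c) * Real.exp (-t / c) * t ^ 2)
  simp only [sq_abs] at h1
  rw [h1]
  have h2 : ∫ t in Set.Ioi (0 : ℝ), 1 / (2 * c) * Real.exp (-t / c) * t ^ 2
      = 1 / (2 * c) * ∫ t in Set.Ioi (0 : ℝ), t ^ ((3 : ℝ) - 1) * Real.exp (-(1 / c * t)) := by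
    rw [← integral_const_mul]
    refine setIntegral_congr_fun measurableSet_Ioi fun t _ => ?_
    have e1 : t ^ ((3 : ℝ) - 1) = t ^ 2 := by norm_num
    have e2 : -t / c = -(1 / c * t) := by ring
    simp only [e1, e2]
    ring
  rw [h2, Real.integral_rpow_mul_exp_neg_mul_Ioi (by norm_num) (by positivity), one_div_one_div]
  have h3 : Real.Gamma 3 = 2 := by
    have := Real.Gamma_nat_eq_factorial 2
    rw [show ((2 : ℕ) : ℝ) + 1 = 3 by norm_num] at this
    rw [this]
    norm_num [Nat.factorial]
  have h4 : c ^ (3 : ℝ) = c ^ 3 := by norm_cast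
  rw [h3, h4]
  field_simp

variable {Ω : Type*} [MeasurableSpace Ω] {P : Measure Ω} {X : Ω → ℝ} {c : ℝ}

lemma integral_eq_zero_of_hasLaw_laplace (hX : HasLaw X (laplaceMeasure c) P) (hc : 0 < c) :
    ∫ ω, X ω ∂P = 0 := by
  rw [hX.integral_eq, integral_id_laplaceMeasure hc]

lemma integral_sq_of_hasLaw_laplace (hX : HasLaw X (laplaceMeasure c) P) (hc : 0 < c) :
    ∫ ω, X ω ^ 2 ∂P = 2 * c ^ 2 := by
  rw [← integral_sq_laplaceMeasure hc]
  exact hX.integral_comp (f := fun t => t ^ 2) (by fun_prop)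

lemma memLp_of_hasLaw_laplace (hX : HasLaw X (laplaceMeasure c) P) (hc : 0 < c) :
    MemLp X 2 P := by
  rw [memLp_two_iff_integrable_sq hX.aemeasurable.aestronglyMeasurable]
  -- A non-integrable square would have Bochner integral 0, but the computed second moment is
  -- positive.
  by_contra h
  have h1 := integral_sq_of_hasLaw_laplace hX hc
  rw [integral_undef h] at h1
  have : 0 < 2 * c ^ 2 := by positivity
  linarith

end Laplace

/-! ### Almost sure summability -/

section Series

variable {Ω : Type*} [MeasurableSpace Ω] {P : Measure Ω}

lemma ae_summable_of_summable_integral {g : ℕ → Ω → ℝ} (hg0 : ∀ k ω, 0 ≤ g k ω)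
    (hg : ∀ k, Integrable (g k) P) (hs : Summable fun k => ∫ ω, g k ω ∂P) :
    (∀ᵐ ω ∂P, Summable fun k => g k ω) ∧ Integrable (fun ω => ∑' k, g k ω) P := by
  have hlint : ∫⁻ ω, ∑' k, ENNReal.ofReal (g k ω) ∂P ≠ ⊤ := by
    rw [lintegral_tsum fun k => (hg k).aemeasurable.ennreal_ofReal]
    simp_rw [← fun k => ofReal_integral_eq_lintegral_ofReal (hg k) (ae_of_all _ (hg0 k))]
    exact hs.tsum_ofReal_ne_top
  have hm : AEMeasurable (fun ω => ∑' k, ENNReal.ofReal (g k ω)) P :=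
    AEMeasurable.tsum fun k => (hg k).aemeasurable.ennreal_ofReal
  have hae : ∀ᵐ ω ∂P, ∑' k, ENNReal.ofReal (g k ω) ≠ ⊤ :=
    (ae_lt_top' hm hlint).mono fun ω h => h.ne
  have htr : ∀ k ω, (ENNReal.ofReal (g k ω)).toReal = g k ω := fun k ω =>
    ENNReal.toReal_ofReal (hg0 k ω)
  refine ⟨hae.mono fun ω h => ?_, ?_⟩
  · simpa only [htr] using ENNReal.summable_toReal h
  · refine (integrable_toReal_of_lintegral_ne_top hm hlint).congr (hae.mono fun ω h => ?_)
    simp only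
    rw [ENNReal.tsum_toReal_eq fun _ => ENNReal.ofReal_ne_top]
    simp only [htr]

/-- Cauchy-Schwarz with the geometric weights `q ^ k`; summability itself follows from `s k ≤ q ^ k
+ s k ^ 2 / q ^ k`. -/
lemma summable_and_tsum_sq_le {s : ℕ → ℝ} {q : ℝ} (hs : ∀ k, 0 ≤ s k) (hq0 : 0 < q) (hq1 : q < 1)
    (h : Summable fun k => s k ^ 2 / q ^ k) :
    Summable s ∧ (∑' k, s k) ^ 2 ≤ 1 / (1 - q) * ∑' k, s k ^ 2 / q ^ k := by
  have hgeo := summable_geometric_of_lt_one hq0.le hq1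
  have hqk : ∀ k, 0 < q ^ k := fun k => by positivity
  have hsum : Summable s := by
    refine Summable.of_nonneg_of_le hs (fun k => ?_) (hgeo.add h)
    have h1 : s k ^ 2 = q ^ k * (s k ^ 2 / q ^ k) := by have := (hqk k).ne'; field_simp
    have h2 : 0 ≤ s k ^ 2 / q ^ k := div_nonneg (sq_nonneg _) (hqk k).le
    have h3 := hqk k
    nlinarith [sq_nonneg (q ^ k - s k ^ 2 / q ^ k), hs k]
  refine ⟨hsum, ?_⟩
  refine le_of_tendsto ((hsum.hasSum.tendsto_sum_nat).pow 2) (Eventually.of_forall fun N => ?_)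
  have h1 := Finset.sum_sq_le_sum_mul_sum_of_sq_le_mul (Finset.range N) (r := s)
    (f := fun k => q ^ k) (g := fun k => s k ^ 2 / q ^ k) (fun k _ => (hqk k).le)
    (fun k _ => div_nonneg (sq_nonneg _) (hqk k).le)
    (fun k _ => by have := (hqk k).ne'; field_simp; exact le_rfl)
  refine h1.trans ?_
  have h2 := hgeo.sum_le_tsum (Finset.range N) fun k _ => (hqk k).le
  rw [tsum_geometric_of_lt_one hq0.le hq1, ← one_div] at h2
  have h3 := h.sum_le_tsum (Finset.range N) fun k _ => div_nonneg (sq_nonneg _) (hqk k).le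
  refine mul_le_mul h2 h3 (Finset.sum_nonneg fun k _ => div_nonneg (sq_nonneg _) (hqk k).le) ?_
  have : 0 < 1 - q := by linarith
  positivity

end Series

/-! ### The filtration of the noise -/

section History

variable {n p : ℕ} {Ω : Type*}

lemma measurable_stack [MeasurableSpace Ω] {X : Ω → Stack n p}
    (h : ∀ i j, Measurable fun ω => X ω i j) : Measurable X :=
  measurable_pi_iff.2 fun i =>
    (WithLp.measurable_toLp 2 (Fin p → ℝ)).comp (measurable_pi_iff.2 fun j => h i j)

/-- The information contained in the first `k` noises. -/
abbrev history (ξ : ℕ → Ω → Stack n p) (k : ℕ) : MeasurableSpace Ω :=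
  ⨆ a ∈ {a : ℕ × Fin n × Fin p | a.1 < k},
    MeasurableSpace.comap (fun ω => ξ (a.1 + 1) ω a.2.1 a.2.2) inferInstance

lemma measurable_history (ξ : ℕ → Ω → Stack n p) {m k : ℕ} (h : m < k) :
    Measurable[history ξ k] (ξ (m + 1)) := by
  refine @measurable_stack n p Ω (history ξ k) _ fun i j => ?_
  rw [measurable_iff_comap_le]
  exact le_iSup₂_of_le (f := fun (a : ℕ × Fin n × Fin p) (_ : a ∈ {a | a.1 < k}) =>
    MeasurableSpace.comap (fun ω => ξ (a.1 + 1) ω a.2.1 a.2.2) inferInstance) (m, i, j) h le_rfl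

end History

/-! ### Total noise and orthogonality to the past -/

section Noise

variable {n p : ℕ} {Ω : Type*} [MeasurableSpace Ω] {P : Measure Ω} {ν : ℕ → ℝ}
  {ξ : ℕ → Ω → Stack n p}

lemma IsLaplaceNoise.memLp (hξ : IsLaplaceNoise P ν ξ) (hν : ∀ k, 0 < ν (k + 1)) (k : ℕ)
    (i : Fin n) (j : Fin p) : MemLp (fun ω => ξ (k + 1) ω i j) 2 P :=
  memLp_of_hasLaw_laplace (hξ.hasLaw (k + 1) (by omega) i j) (hν k)

lemma IsLaplaceNoise.integrable_sq (hξ : IsLaplaceNoise P ν ξ) (hν : ∀ k, 0 < ν (k + 1)) (k : ℕ) :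
    Integrable (fun ω => stackNorm (ξ (k + 1) ω) ^ 2) P := by
  simp_rw [stackNorm_sq, EuclideanSpace.norm_sq_eq, Real.norm_eq_abs, sq_abs]
  exact integrable_finsetSum _ fun i _ => integrable_finsetSum _ fun j _ =>
    (hξ.memLp hν k i j).integrable_sq

lemma IsLaplaceNoise.integral_sq (hξ : IsLaplaceNoise P ν ξ) (hν : ∀ k, 0 < ν (k + 1)) (k : ℕ) :
    ∫ ω, stackNorm (ξ (k + 1) ω) ^ 2 ∂P = n * (2 * p * ν (k + 1) ^ 2) := by
  simp_rw [stackNorm_sq, EuclideanSpace.norm_sq_eq, Real.norm_eq_abs, sq_abs]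
  rw [integral_finsetSum _ fun i _ => integrable_finsetSum _ fun j _ =>
    (hξ.memLp hν k i j).integrable_sq]
  have h : ∀ i, ∫ ω, ∑ j, ξ (k + 1) ω i j ^ 2 ∂P = 2 * p * ν (k + 1) ^ 2 := by
    intro i
    rw [integral_finsetSum _ fun j _ => (hξ.memLp hν k i j).integrable_sq]
    simp_rw [fun j => integral_sq_of_hasLaw_laplace (hξ.hasLaw (k + 1) (by omega) i j) (hν k)]
    simp
    ring
  simp [h]

/-- Geometrically decaying Laplace noise is almost surely summable, with square-integrable sum. -/
lemma IsLaplaceNoise.exists_tsum_sq_le (hξ : IsLaplaceNoise P ν ξ) {ν₀ q : ℝ} (hν₀ : 0 < ν₀)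
    (hq0 : 0 < q) (hq1 : q < 1) (hν : ∀ k, ν (k + 1) = ν₀ * q ^ k) :
    ∃ T : Ω → ℝ, Integrable T P ∧ (∀ᵐ ω ∂P, (Summable fun k => stackNorm (ξ (k + 1) ω)) ∧
      (∑' k, stackNorm (ξ (k + 1) ω)) ^ 2 ≤ T ω) ∧
      ∫ ω, T ω ∂P = 2 * n * p / (1 - q) ^ 2 * ν₀ ^ 2 := by
  have hν' : ∀ k, 0 < ν (k + 1) := fun k => by rw [hν]; positivity
  have hg0 : ∀ k ω, 0 ≤ stackNorm (ξ (k + 1) ω) ^ 2 / q ^ k := fun k ω => by positivity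
  have hgi : ∀ k, Integrable (fun ω => stackNorm (ξ (k + 1) ω) ^ 2 / q ^ k) P := fun k =>
    (hξ.integrable_sq hν' k).div_const _
  -- The second moments decay like `q ^ (2 * k)`, so division by the weight still leaves a geometric
  -- series.
  have hint : ∀ k, ∫ ω, stackNorm (ξ (k + 1) ω) ^ 2 / q ^ k ∂P
      = 2 * n * p * ν₀ ^ 2 * q ^ k := by
    intro k
    rw [integral_div, hξ.integral_sq hν', hν]
    have : q ^ k ≠ 0 := by positivity
    field_simp
  have hgeo := summable_geometric_of_lt_one hq0.le hq1
  have hs : Summable fun k => ∫ ω, stackNorm (ξ (k + 1) ω) ^ 2 / q ^ k ∂P := by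
    simp_rw [hint]; exact hgeo.mul_left _
  obtain ⟨hae, hTi⟩ := ae_summable_of_summable_integral hg0 hgi hs
  refine ⟨fun ω => 1 / (1 - q) * ∑' k, stackNorm (ξ (k + 1) ω) ^ 2 / q ^ k, hTi.const_mul _,
    hae.mono fun ω h => summable_and_tsum_sq_le (fun _ => stackNorm_nonneg _) hq0 hq1 h, ?_⟩
  have hs' : Summable fun k => ∫ ω, ‖stackNorm (ξ (k + 1) ω) ^ 2 / q ^ k‖ ∂P := by
    simpa only [Real.norm_of_nonneg (hg0 _ _)] using hs
  rw [integral_const_mul, ← integral_tsum_of_summable_integral_norm hgi hs']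
  simp_rw [hint]
  rw [tsum_mul_left, tsum_geometric_of_lt_one hq0.le hq1]
  have : 1 - q ≠ 0 := by linarith
  field_simp

lemma history_le (hm : ∀ k, Measurable (ξ (k + 1))) (k : ℕ) :
    history ξ k ≤ ‹MeasurableSpace Ω› := by
  refine iSup₂_le fun a _ => ?_
  rw [← measurable_iff_comap_le]
  have := hm a.1
  fun_prop

/-- The index `(k, i, j)` lies outside the indices generating `history ξ k`, so the product
factorizes and the centred factor kills it. -/
lemma IsLaplaceNoise.integral_mul_eq_zero (hξ : IsLaplaceNoise P ν ξ) (hν : ∀ k, 0 < ν (k + 1))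
    (hm : ∀ k, Measurable (ξ (k + 1))) {k : ℕ} {Φ : Ω → ℝ} (hΦ : Measurable[history ξ k] Φ)
    (i : Fin n) (j : Fin p) : ∫ ω, ξ (k + 1) ω i j * Φ ω ∂P = 0 := by
  have hmc : ∀ a : ℕ × Fin n × Fin p, Measurable fun ω => ξ (a.1 + 1) ω a.2.1 a.2.2 := fun a => by
    have := hm a.1
    fun_prop
  have h1 := indep_iSup_of_disjoint (fun a => (hmc a).comap_le) hξ.indep
    (S := {(k, i, j)}) (T := {a : ℕ × Fin n × Fin p | a.1 < k}) (by simp)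
  have h2 : IndepFun (fun ω => ξ (k + 1) ω i j) Φ P := by
    rw [IndepFun_iff_Indep]
    refine indep_of_indep_of_le_left (indep_of_indep_of_le_right h1 hΦ.comap_le) ?_
    simp
  have h3 := h2.integral_mul_eq_mul_integral (hmc (k, i, j)).aestronglyMeasurable
    (hΦ.mono (history_le hm k) le_rfl).aestronglyMeasurable
  rw [integral_eq_zero_of_hasLaw_laplace (hξ.hasLaw (k + 1) (by omega) i j) (hν k), zero_mul] at h3
  exact h3

/-- Fresh noise is orthogonal to every square-integrable function of the past. -/
lemma IsLaplaceNoise.integral_inner_eq_zero (hξ : IsLaplaceNoise P ν ξ)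
    (hν : ∀ k, 0 < ν (k + 1)) (hm : ∀ k, Measurable (ξ (k + 1))) {k : ℕ} {Φ : Ω → Vec p}
    (hΦ : Measurable[history ξ k] Φ) (hΦ2 : Integrable (fun ω => ‖Φ ω‖ ^ 2) P) (i : Fin n) :
    Integrable (fun ω => inner ℝ (ξ (k + 1) ω i) (Φ ω)) P ∧
      ∫ ω, inner ℝ (ξ (k + 1) ω i) (Φ ω) ∂P = 0 := by
  have hΦm : ∀ j, Measurable[history ξ k] fun ω => Φ ω j := fun j =>
    (show Measurable fun v : Vec p => v j by fun_prop).comp hΦ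
  have hin : ∀ ω, inner ℝ (ξ (k + 1) ω i) (Φ ω) = ∑ j, ξ (k + 1) ω i j * Φ ω j := fun ω => by
    rw [PiLp.inner_apply]
    exact Finset.sum_congr rfl fun j _ => by simp [mul_comm]
  have hΦL : ∀ j, MemLp (fun ω => Φ ω j) 2 P := fun j => by
    have hms := ((hΦm j).mono (history_le hm k) le_rfl).aestronglyMeasurable (μ := P)
    rw [memLp_two_iff_integrable_sq hms]
    refine hΦ2.mono' (hms.pow 2) (ae_of_all _ fun ω => ?_)
    rw [Real.norm_of_nonneg (sq_nonneg _), ← sq_abs, ← Real.norm_eq_abs]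
    exact pow_le_pow_left₀ (norm_nonneg _) (PiLp.norm_apply_le _ _) 2
  have hmul : ∀ j, Integrable (fun ω => ξ (k + 1) ω i j * Φ ω j) P := fun j =>
    (hξ.memLp hν k i j).integrable_mul (hΦL j)
  simp_rw [hin]
  refine ⟨integrable_finsetSum _ fun j _ => hmul j, ?_⟩
  rw [integral_finsetSum _ fun j _ => hmul j]
  exact Finset.sum_eq_zero fun j _ => hξ.integral_mul_eq_zero hν hm (hΦm j) i j

end Noise

/-! ### Measurability of the states -/

section Measurability

variable {n p : ℕ} {f : Fin n → Vec p → ℝ} {L μ : ℝ}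

/-- Only the first `k` noises need be measurable, and the σ-algebra is arbitrary, so the lemma also
applies to `history ξ k`. -/
lemma measurable_algState {Ω : Type*} [MeasurableSpace Ω]
    (hf : ∀ i, IsSmoothStronglyConvex L μ (f i)) (W : Matrix (Fin n) (Fin n) ℝ) (β : ℝ)
    (α : ℕ → ℝ) (x₀ : Stack n p) {ξ : ℕ → Ω → Stack n p} (k : ℕ)
    (hm : ∀ m, m < k → Measurable (ξ (m + 1))) :
    Measurable fun ω => algState f W β α x₀ (fun m => ξ m ω) k := by
  induction k with
  | zero => exact measurable_const
  | succ k ih =>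
    have h1 := ih fun m h => hm m (h.trans k.lt_succ_self)
    have h2 := hm k k.lt_succ_self
    have hg : ∀ i, Measurable (∇ (f i)) := fun i => (hf i).continuous_gradient.measurable
    simp only [algState, algStep]
    have hz : ∀ i, Measurable fun ω => (algState f W β α x₀ (fun m => ξ m ω) k).1 i
        + ξ (k + 1) ω i := fun i => by fun_prop
    have hzb : ∀ i, Measurable fun ω => ∑ j, W i j •
        ((algState f W β α x₀ (fun m => ξ m ω) k).1 j + ξ (k + 1) ω j) := fun i => by fun_prop
    have hy : ∀ i, Measurable fun ω => (algState f W β α x₀ (fun m => ξ m ω) k).2 i :=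
      fun i => by fun_prop
    refine Measurable.prodMk (measurable_pi_iff.2 fun i => ?_) (measurable_pi_iff.2 fun i => ?_)
    · exact (hzb i).sub (((hy i).add (((hz i).sub (hzb i)).const_smul β)).add
        ((hg i).comp (hz i)) |>.const_smul (α (k + 1)))
    · exact (hy i).add (((hz i).sub (hzb i)).const_smul β)

end Measurability

/-! ### One-step estimate of the optimization error -/

section OneStep

variable {n p : ℕ} {f : Fin n → Vec p → ℝ} {L μ : ℝ} {W : Matrix (Fin n) (Fin n) ℝ}

lemma norm_rowAvg_sq_le (hn : 0 < n) (s : Stack n p) :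
    ‖rowAvg s‖ ^ 2 ≤ 1 / (n : ℝ) * stackNorm s ^ 2 := by
  have hn' : (0 : ℝ) < n := by exact_mod_cast hn
  have h1 := pow_le_pow_left₀ (norm_nonneg _) (norm_rowAvg_le_sum s) 2
  have h2 := sq_sum_le_card_mul_sum_sq (s := Finset.univ) (f := fun i => ‖s i‖)
  rw [Finset.card_univ, Fintype.card_fin, ← stackNorm_sq] at h2
  refine h1.trans ?_
  rw [mul_pow]
  calc (1 / (n : ℝ)) ^ 2 * (∑ i, ‖s i‖) ^ 2 ≤ (1 / (n : ℝ)) ^ 2 * (n * stackNorm s ^ 2) := by gcongr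
    _ = 1 / (n : ℝ) * stackNorm s ^ 2 := by field_simp

lemma stackNorm_add_sq (s t : Stack n p) :
    stackNorm (s + t) ^ 2 = stackNorm s ^ 2 + 2 * ∑ i, inner ℝ (t i) (s i) + stackNorm t ^ 2 := by
  simp_rw [stackNorm_sq, Finset.mul_sum, ← Finset.sum_add_distrib]
  refine Finset.sum_congr rfl fun i _ => ?_
  rw [Pi.add_apply, norm_add_sq_real, real_inner_comm]

lemma stackNorm_gradStack_sub_le (hf : ∀ i, IsSmoothStronglyConvex L μ (f i)) (hL : 0 ≤ L)
    (s t : Stack n p) : stackNorm (gradStack f s - gradStack f t) ≤ L * stackNorm (s - t) :=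
  stackNorm_le_of_norm_le hL fun i => (hf i).smooth _ _

/-- The state-dependent direction against which the fresh noise is tested. -/
noncomputable def drift (f : Fin n → Vec p → ℝ) (L μ α : ℝ) (xstar : Vec p) (x : Stack n p) :
    Stack n p :=
  fun i => (α * L ^ 2 / (n * μ)) • deviation x i
    + (1 / (n : ℝ)) • (rowAvg x - xstar - α • rowAvg (gradStack f x))

lemma sum_inner_drift (ξ x : Stack n p) (α : ℝ) (xstar : Vec p) :
    ∑ i, inner ℝ (ξ i) (drift f L μ α xstar x i)
      = α * L ^ 2 / (n * μ) * ∑ i, inner ℝ (ξ i) (deviation x i)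
        + inner ℝ (rowAvg ξ) (rowAvg x - xstar - α • rowAvg (gradStack f x)) := by
  simp only [drift, inner_add_right, inner_smul_right, Finset.sum_add_distrib, ← Finset.mul_sum,
    inner_rowAvg_left]

/-- Convexity of the square at `a` and `b / μ` with weights `1 - α μ` and `α μ`. -/
lemma sq_add_le_of_convex {t a b μ α : ℝ} (hμ : 0 < μ) (hα : 0 ≤ α) (hαμ : α * μ ≤ 1)
    (ht0 : 0 ≤ t) (ht : t ≤ (1 - α * μ) * a + α * b) :
    t ^ 2 ≤ (1 - α * μ) * a ^ 2 + α / μ * b ^ 2 := by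
  have h1 := pow_le_pow_left₀ ht0 ht 2
  have h2 : (1 - α * μ) * a ^ 2 + α / μ * b ^ 2 - ((1 - α * μ) * a + α * b) ^ 2
      = (1 - α * μ) * (α * μ) * (a - b / μ) ^ 2 := by
    field_simp
    ring
  have h3 : 0 ≤ (1 - α * μ) * (α * μ) * (a - b / μ) ^ 2 :=
    mul_nonneg (mul_nonneg (by linarith) (by positivity)) (sq_nonneg _)
  linarith

/-- One-step estimate of the optimization error along a noise realization. -/
lemma optErr_algStep_le (hW : IsWeightMatrix W) (hf : ∀ i, IsSmoothStronglyConvex L μ (f i))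
    (hμ : 0 < μ) (hμL : μ ≤ L) {xstar : Vec p} (hx : ∀ x, globalCost f xstar ≤ globalCost f x)
    (β : ℝ) {α : ℝ} (hα : 0 ≤ α) (hα' : α ≤ 2 / (μ + L)) (ξ x y : Stack n p)
    (hy : rowAvg y = 0) :
    optErr xstar (algStep f W β α ξ (x, y)).1
      ≤ (1 - α * μ) * optErr xstar x + α * L ^ 2 / (n * μ) * consensusErr x
        + (1 + 2 * α * L + α * L ^ 2 / μ) / n * stackNorm ξ ^ 2
        + 2 * ∑ i, inner ℝ (ξ i) (drift f L μ α xstar x i) := by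
  have hn := hW.pos
  have hn' : (0 : ℝ) < n := by exact_mod_cast hn
  have hL : 0 ≤ L := hμ.le.trans hμL
  have hαμ : α * μ ≤ 1 := by
    have : α * (μ + L) ≤ 2 := (le_div_iff₀ (by linarith)).1 hα'
    nlinarith
  have hgc := isSmoothStronglyConvex_globalCost hn hf
  rw [sum_inner_drift, consensusErr_eq, optErr, optErr, rowAvg_algStep_fst hW _ _ _ _ _ hy]
  have hcontr := hgc.norm_gradientStep_sub_le hμ hμL hα hα' (rowAvg x) xstar
  rw [gradient_globalCost_eq_zero hx, sub_zero,
    (hasGradientAt_globalCost (fun i => (hf i).differentiable) (rowAvg x)).gradient] at hcontr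
  have hb := norm_rowAvg_sq_le hn ξ
  have hh := norm_rowAvg_sq_le hn (gradStack f (x + ξ) - gradStack f fun _ => rowAvg x)
  have hc := norm_rowAvg_sq_le hn (gradStack f (x + ξ) - gradStack f x)
  have hh' := pow_le_pow_left₀ (stackNorm_nonneg _)
    (stackNorm_gradStack_sub_le hf hL (x + ξ) fun _ => rowAvg x) 2
  have hc' := pow_le_pow_left₀ (stackNorm_nonneg _)
    (stackNorm_gradStack_sub_le hf hL (x + ξ) x) 2
  -- The square is expanded exactly, since its cross term with the noise will vanish in expectation.
  rw [show ((x + ξ) - fun _ => rowAvg x) = deviation x + ξ by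
    ext1 i; simp [deviation]; abel, mul_pow, stackNorm_add_sq] at hh'
  rw [add_sub_cancel_left, mul_pow] at hc'
  rw [rowAvg_sub] at hh hc
  have hF : rowAvg (gradStack f fun _ => rowAvg x) = rowAvg fun i => ∇ (f i) (rowAvg x) := rfl
  rw [hF] at hh
  generalize (rowAvg fun i => ∇ (f i) (rowAvg x)) = F at hcontr hh
  generalize rowAvg (gradStack f (x + ξ)) = gz at *
  generalize rowAvg (gradStack f x) = gx at *
  generalize stackNorm (gradStack f (x + ξ) - gradStack f x) ^ 2 = u1 at *
  generalize stackNorm (gradStack f (x + ξ) - gradStack f fun _ => rowAvg x) ^ 2 = u2 at *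
  have hS0 : 0 ≤ stackNorm ξ ^ 2 := sq_nonneg _
  generalize stackNorm ξ ^ 2 = S at *
  generalize stackNorm (deviation x) ^ 2 = cons at *
  generalize ∑ i, inner ℝ (ξ i) (deviation x i) = I at *
  generalize rowAvg ξ = b at *
  generalize rowAvg x = xb at *
  have e0 : xb + b - α • gz - xstar = (xb - xstar - α • gz) + b := by abel
  rw [e0]
  generalize xb - xstar = e at *
  rw [norm_add_sq_real]
  have e1 : ‖e - α • gz‖ ^ 2 ≤ (1 - α * μ) * ‖e‖ ^ 2 + α / μ * ‖gz - F‖ ^ 2 := by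
    refine sq_add_le_of_convex hμ hα hαμ (norm_nonneg _) ?_
    have : e - α • gz = (e - α • F) - α • (gz - F) := by rw [smul_sub]; abel
    rw [this]
    refine (norm_sub_le _ _).trans (add_le_add hcontr ?_)
    rw [norm_smul, Real.norm_of_nonneg hα]
  -- The gradient at the noisy point depends on the fresh noise. Replacing it by the one at `x`
  -- leaves a direction determined by the past; the correction is quadratic in the noise.
  have e2 : inner ℝ (e - α • gz) b = inner ℝ b (e - α • gx) - α * inner ℝ b (gz - gx) := by
    rw [real_inner_comm, ← inner_smul_right, ← inner_sub_right, smul_sub]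
    congr 1
    abel
  have e3 : -inner ℝ b (gz - gx) ≤ L * (1 / n * S) := by
    refine (neg_le_abs _).trans ((abs_real_inner_le_norm _ _).trans ?_)
    refine le_of_sq_le_sq ?_ (by positivity)
    rw [mul_pow]
    calc ‖b‖ ^ 2 * ‖gz - gx‖ ^ 2 ≤ (1 / n * S) * (1 / n * (L ^ 2 * S)) := by
          refine mul_le_mul hb (hc.trans ?_) (sq_nonneg _) (by positivity)
          gcongr
      _ = (L * (1 / n * S)) ^ 2 := by ring
  have e4 : α / μ * ‖gz - F‖ ^ 2 ≤ α / μ * (1 / n * (L ^ 2 * (cons + 2 * I + S))) := by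
    have : 0 ≤ α / μ := by positivity
    gcongr
    exact hh.trans (by gcongr)
  have e5 := mul_le_mul_of_nonneg_left e3 hα
  have e6 : α / μ * (1 / n * (L ^ 2 * (cons + 2 * I + S)))
      = α * L ^ 2 / (n * μ) * cons + 2 * (α * L ^ 2 / (n * μ) * I) + α * L ^ 2 / μ / n * S := by
    field_simp
  have e7 : (1 + 2 * α * L + α * L ^ 2 / μ) / n * S
      = 1 / n * S + 2 * (α * (L * (1 / n * S))) + α * L ^ 2 / μ / n * S := by
    field_simp
  rw [e2, e7]
  linarith

/-- Transfers integrability from the two errors to the squared test direction; the value of the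
constant is immaterial. -/
lemma exists_norm_drift_sq_le (hf : ∀ i, IsSmoothStronglyConvex L μ (f i)) (α : ℝ)
    (xstar : Vec p) : ∃ K : ℝ, ∀ (x : Stack n p) (i : Fin n),
      ‖drift f L μ α xstar x i‖ ^ 2 ≤ K * (1 + consensusErr x + optErr xstar x) := by
  obtain ⟨A, hA⟩ : ∃ A, A = |α * L ^ 2 / (n * μ)| := ⟨_, rfl⟩
  obtain ⟨G, hG⟩ : ∃ G, G = stackNorm (gradStack f fun _ => xstar) := ⟨_, rfl⟩
  have hA0 : 0 ≤ A := hA ▸ abs_nonneg _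
  have hG0 : 0 ≤ G := hG ▸ stackNorm_nonneg _
  obtain ⟨B, hB⟩ : ∃ B, B = A + (1 / (n : ℝ)) * (1 + |α| * (G + |L| * (1 + n))) := ⟨_, rfl⟩
  refine ⟨3 * B ^ 2, fun x i => ?_⟩
  have hg := stackNorm_gradStack_le hf xstar x 0
  have h0 : stackNorm (0 : Stack n p) = 0 := norm_zero (E := PiLp 2 fun _ : Fin n => Vec p)
  rw [add_zero, h0, add_zero, ← hG] at hg
  have h1 : ‖drift f L μ α xstar x i‖ ≤ A * stackNorm (deviation x)
      + 1 / (n : ℝ) * (‖rowAvg x - xstar‖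
        + |α| * (G + |L| * (stackNorm (deviation x) + n * ‖rowAvg x - xstar‖))) := by
    refine (norm_add_le _ _).trans (add_le_add ?_ ?_)
    · rw [norm_smul, Real.norm_eq_abs, ← hA]
      exact mul_le_mul_of_nonneg_left (norm_le_stackNorm _ _) hA0
    · rw [norm_smul, Real.norm_of_nonneg (by positivity)]
      refine mul_le_mul_of_nonneg_left ?_ (by positivity)
      refine (norm_sub_le _ _).trans (add_le_add le_rfl ?_)
      rw [norm_smul, Real.norm_eq_abs]
      exact mul_le_mul_of_nonneg_left ((norm_rowAvg_le _).trans hg) (abs_nonneg _)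
  rw [consensusErr_eq, optErr]
  have hu := stackNorm_nonneg (deviation x)
  have hw := norm_nonneg (rowAvg x - xstar)
  generalize stackNorm (deviation x) = u at *
  generalize ‖rowAvg x - xstar‖ = w at *
  have h2 : ‖drift f L μ α xstar x i‖ ≤ B * (1 + u + w) := by
    refine h1.trans ?_
    rw [hB]
    have hr : 0 ≤ 1 / (n : ℝ) := by positivity
    have hLn := abs_nonneg L
    have hal := abs_nonneg α
    generalize 1 / (n : ℝ) = r at *
    generalize |L| = l at *
    generalize |α| = a at *
    have hN : (0 : ℝ) ≤ n := Nat.cast_nonneg n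
    generalize (n : ℝ) = N at *
    have : (A + r * (1 + a * (G + l * (1 + N)))) * (1 + u + w)
        - (A * u + r * (w + a * (G + l * (u + N * w))))
        = A * (1 + w) + r * (1 + u) + r * a * (G * (u + w) + l * (1 + N + N * u + w)) := by ring
    have : 0 ≤ A * (1 + w) + r * (1 + u) + r * a * (G * (u + w) + l * (1 + N + N * u + w)) := by
      positivity
    linarith
  refine (pow_le_pow_left₀ (norm_nonneg _) h2 2).trans ?_
  rw [mul_pow]
  have h3 : (1 + u + w) ^ 2 ≤ 3 * (1 + u ^ 2 + w ^ 2) := by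
    nlinarith [sq_nonneg (u - w), sq_nonneg (1 - u), sq_nonneg (1 - w)]
  have := mul_le_mul_of_nonneg_left h3 (sq_nonneg B)
  linarith

lemma measurable_rowAvg : Measurable (rowAvg : Stack n p → Vec p) := by
  unfold rowAvg
  fun_prop

lemma measurable_consensusErr : Measurable (consensusErr : Stack n p → ℝ) := by
  have h := measurable_rowAvg (n := n) (p := p)
  unfold consensusErr
  fun_prop

lemma measurable_optErr (xstar : Vec p) : Measurable (optErr xstar : Stack n p → ℝ) := by
  have h := measurable_rowAvg (n := n) (p := p)
  unfold optErr
  fun_prop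

lemma measurable_drift (hf : ∀ i, IsSmoothStronglyConvex L μ (f i)) (α : ℝ) (xstar : Vec p)
    (i : Fin n) : Measurable fun x : Stack n p => drift f L μ α xstar x i := by
  have h := measurable_rowAvg (n := n) (p := p)
  have hg : Measurable (gradStack f) := measurable_pi_iff.2 fun i =>
    (hf i).continuous_gradient.measurable.comp (measurable_pi_apply i)
  have h2 : Measurable fun x : Stack n p => rowAvg (gradStack f x) := h.comp hg
  unfold drift deviation
  fun_prop

end OneStep

/-! ### Expected errors -/

section Expectation

variable {n p : ℕ} {f : Fin n → Vec p → ℝ} {L μ : ℝ} {W : Matrix (Fin n) (Fin n) ℝ}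
  {Ω : Type*} [MeasurableSpace Ω] {P : Measure Ω} {ν : ℕ → ℝ}
  {ξ : ℕ → Ω → Stack n p}

lemma tendsto_optErr (xstar : Vec p) {X : ℕ → Stack n p} {v : Vec p}
    (h : Tendsto (fun k => rowAvg (X k)) atTop (𝓝 v)) :
    Tendsto (fun k => optErr xstar (X k)) atTop (𝓝 (‖v - xstar‖ ^ 2)) :=
  ((h.sub_const xstar).norm).pow 2

lemma sq_le_of_le_mul_one_add {a S t K : ℝ} (ha : 0 ≤ a) (h : a ≤ K * (1 + S)) (hS : S ^ 2 ≤ t) :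
    a ^ 2 ≤ 2 * K ^ 2 * (1 + t) := by
  have h1 := pow_le_pow_left₀ ha h 2
  have h2 : (1 + S) ^ 2 ≤ 2 * (1 + t) := by nlinarith [sq_nonneg (1 - S)]
  have h3 := mul_le_mul_of_nonneg_left h2 (sq_nonneg K)
  rw [mul_pow] at h1
  linarith

lemma scale_le {K r s : ℝ} (hr : 0 ≤ r) (hs : 0 ≤ s) (hK : 0 ≤ K) :
    K * (1 + r * s) ≤ K * (1 + r) * (1 + s) := by
  rw [mul_assoc]
  exact mul_le_mul_of_nonneg_left (by linarith) hK

lemma expectation_of_dominated {F : ℕ → Ω → ℝ} {G H : Ω → ℝ}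
    (hF : ∀ k, AEStronglyMeasurable (F k) P) (hH : Integrable H P)
    (hb : ∀ k, ∀ᵐ ω ∂P, ‖F k ω‖ ≤ H ω) (hlim : ∀ᵐ ω ∂P, Tendsto (F · ω) atTop (𝓝 (G ω))) :
    (∀ k, Integrable (F k) P) ∧ (∀ k, ∫ ω, F k ω ∂P ≤ ∫ ω, H ω ∂P) ∧
      Tendsto (fun k => ∫ ω, F k ω ∂P) atTop (𝓝 (∫ ω, G ω ∂P)) := by
  have hi := fun k => hH.mono' (hF k) (hb k)
  exact ⟨hi, fun k => integral_mono_ae (hi k) hH ((hb k).mono fun ω h => (le_abs_self _).trans h),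
    tendsto_integral_of_dominated_convergence H hF hH hb hlim⟩

/-- One-step estimate of the expected optimization error. -/
lemma integral_optErr_algState_succ_le [IsProbabilityMeasure P] (hW : IsWeightMatrix W)
    (hf : ∀ i, IsSmoothStronglyConvex L μ (f i)) (hμ : 0 < μ) (hμL : μ ≤ L) {xstar : Vec p}
    (hx : ∀ x, globalCost f xstar ≤ globalCost f x) (β : ℝ) {α : ℕ → ℝ} (x₀ : Stack n p)
    (hξ : IsLaplaceNoise P ν ξ) (hν : ∀ k, 0 < ν (k + 1)) (hm : ∀ k, Measurable (ξ (k + 1)))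
    (hcons : ∀ k, Integrable
      (fun ω => consensusErr (algState f W β α x₀ (fun m => ξ m ω) k).1) P)
    (hopt : ∀ k, Integrable
      (fun ω => optErr xstar (algState f W β α x₀ (fun m => ξ m ω) k).1) P)
    (k : ℕ) (hα : 0 ≤ α (k + 1)) (hα' : α (k + 1) ≤ 2 / (μ + L)) :
    ∫ ω, optErr xstar (algState f W β α x₀ (fun m => ξ m ω) (k + 1)).1 ∂P
      ≤ (1 - α (k + 1) * μ) * ∫ ω, optErr xstar (algState f W β α x₀ (fun m => ξ m ω) k).1 ∂P
        + α (k + 1) * L ^ 2 / (n * μ)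
          * ∫ ω, consensusErr (algState f W β α x₀ (fun m => ξ m ω) k).1 ∂P
        + (1 + 2 * α (k + 1) * L + α (k + 1) * L ^ 2 / μ) * (2 * p * ν (k + 1) ^ 2) := by
  have hn' : (0 : ℝ) < n := by exact_mod_cast hW.pos
  have hX : Measurable[history ξ k] fun ω => (algState f W β α x₀ (fun m => ξ m ω) k).1 :=
    measurable_fst.comp (@measurable_algState n p f L μ Ω (history ξ k) hf W β α x₀ ξ k
      fun m h => measurable_history ξ h)
  have hΦ : ∀ i, Measurable[history ξ k] fun ω =>
      drift f L μ (α (k + 1)) xstar (algState f W β α x₀ (fun m => ξ m ω) k).1 i := fun i =>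
    (measurable_drift hf (α (k + 1)) xstar i).comp hX
  obtain ⟨K, hK⟩ := exists_norm_drift_sq_le (n := n) hf (α (k + 1)) xstar
  have hΦ2 : ∀ i, Integrable (fun ω =>
      ‖drift f L μ (α (k + 1)) xstar (algState f W β α x₀ (fun m => ξ m ω) k).1 i‖ ^ 2) P := by
    intro i
    refine Integrable.mono' ((((integrable_const 1).add (hcons k)).add (hopt k)).const_mul K)
      (((hΦ i).mono (history_le hm k) le_rfl).norm.pow_const 2).aestronglyMeasurable
      (ae_of_all _ fun ω => ?_)
    rw [Real.norm_of_nonneg (by positivity)]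
    exact hK _ i
  have hin := fun i => hξ.integral_inner_eq_zero hν hm (hΦ i) (hΦ2 i) i
  have hi1 := (hopt k).const_mul (1 - α (k + 1) * μ)
  have hi2 := (hcons k).const_mul (α (k + 1) * L ^ 2 / (n * μ))
  have hi3 := (hξ.integrable_sq hν k).const_mul
    ((1 + 2 * α (k + 1) * L + α (k + 1) * L ^ 2 / μ) / n)
  have hi4 := (integrable_finsetSum Finset.univ fun i _ => (hin i).1).const_mul 2
  have hle := integral_mono (hopt (k + 1)) (((hi1.add hi2).add hi3).add hi4) fun ω =>
    optErr_algStep_le hW hf hμ hμL hx β hα hα' (ξ (k + 1) ω)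
      (algState f W β α x₀ (fun m => ξ m ω) k).1 (algState f W β α x₀ (fun m => ξ m ω) k).2
      (rowAvg_algState_snd hW β α x₀ (fun m => ξ m ω) k)
  refine hle.trans (le_of_eq ?_)
  rw [integral_add' ((hi1.add hi2).add hi3) hi4, integral_add' (hi1.add hi2) hi3,
    integral_add' hi1 hi2, integral_const_mul, integral_const_mul, integral_const_mul,
    integral_const_mul, integral_finsetSum _ fun i _ => (hin i).1, hξ.integral_sq hν]
  simp_rw [fun i => (hin i).2]
  simp only [Finset.sum_const_zero, mul_zero, add_zero]
  congr 1
  field_simp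

/-- Domination by an integrable function, and the resulting limits of the expected errors. -/
lemma exists_expectation_bound (hW : IsWeightMatrix W)
    (hf : ∀ i, IsSmoothStronglyConvex L μ (f i)) (xstar : Vec p) {β γ : ℝ} (hβ : 0 < β)
    {α : ℕ → ℝ} (hα : ∀ k, 0 ≤ α (k + 1)) (hαγ : ∀ k, α (k + 1) ≤ γ)
    (hαs : Summable fun k => α (k + 1)) (x₀ : Stack n p) {q : ℝ} (hq0 : 0 < q) (hq1 : q < 1) :
    ∃ K : ℝ, 0 < K ∧ ∀ (Ω : Type*) [MeasurableSpace Ω] (P : Measure Ω) [IsProbabilityMeasure P]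
      (ν : ℕ → ℝ) (ξ : ℕ → Ω → Stack n p) (ν₀ : ℝ), IsLaplaceNoise P ν ξ →
      (∀ k, Measurable (ξ (k + 1))) → 0 < ν₀ → (∀ k, ν (k + 1) = ν₀ * q ^ k) →
      (∀ k, Integrable (fun ω => consensusErr (algState f W β α x₀ (fun m => ξ m ω) k).1) P) ∧
      (∀ k, Integrable (fun ω => optErr xstar (algState f W β α x₀ (fun m => ξ m ω) k).1) P) ∧
      Tendsto (fun k => ∫ ω, consensusErr (algState f W β α x₀ (fun m => ξ m ω) k).1 ∂P) atTop
        (𝓝 0) ∧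
      (∃ d, Tendsto (fun k => ∫ ω, optErr xstar (algState f W β α x₀ (fun m => ξ m ω) k).1 ∂P)
        atTop (𝓝 d)) ∧
      (∀ k, ∫ ω, consensusErr (algState f W β α x₀ (fun m => ξ m ω) k).1 ∂P
        ≤ K * (1 + ν₀ ^ 2)) ∧
      (∀ k, ∫ ω, optErr xstar (algState f W β α x₀ (fun m => ξ m ω) k).1 ∂P
        ≤ K * (1 + ν₀ ^ 2)) := by
  obtain ⟨K, hK, hb⟩ := exists_algState_bound hf xstar hW hβ hα hαγ hαs x₀
  have hr : 0 ≤ 2 * n * p / (1 - q) ^ 2 := by positivity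
  have hK' : 0 < 2 * K ^ 2 * (1 + 2 * n * p / (1 - q) ^ 2) := by positivity
  refine ⟨2 * K ^ 2 * (1 + 2 * n * p / (1 - q) ^ 2), hK', ?_⟩
  intro Ω _ P _ ν ξ ν₀ hξ hm hν₀ hν
  obtain ⟨T, hT, hae, hTint⟩ := hξ.exists_tsum_sq_le hν₀ hq0 hq1 hν
  have hX : ∀ k, Measurable fun ω => (algState f W β α x₀ (fun m => ξ m ω) k).1 := fun k =>
    measurable_fst.comp (measurable_algState hf W β α x₀ k fun m _ => hm m)
  have hcm : ∀ k, AEStronglyMeasurable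
      (fun ω => consensusErr (algState f W β α x₀ (fun m => ξ m ω) k).1) P := fun k =>
    (measurable_consensusErr.comp (hX k)).aestronglyMeasurable
  have hom : ∀ k, AEStronglyMeasurable
      (fun ω => optErr xstar (algState f W β α x₀ (fun m => ξ m ω) k).1) P := fun k =>
    ((measurable_optErr xstar).comp (hX k)).aestronglyMeasurable
  have hHi : Integrable (fun ω => 2 * K ^ 2 * (1 + T ω)) P :=
    ((integrable_const 1).add hT).const_mul _
  have hHint : ∫ ω, 2 * K ^ 2 * (1 + T ω) ∂P
      ≤ 2 * K ^ 2 * (1 + 2 * n * p / (1 - q) ^ 2) * (1 + ν₀ ^ 2) := by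
    rw [integral_const_mul, integral_add (integrable_const 1) hT, hTint]
    simp only [integral_const, probReal_univ, smul_eq_mul, mul_one]
    exact scale_le hr (sq_nonneg _) (by positivity)
  have hcb : ∀ k, ∀ᵐ ω ∂P, ‖consensusErr (algState f W β α x₀ (fun m => ξ m ω) k).1‖
      ≤ 2 * K ^ 2 * (1 + T ω) := fun k => by
    filter_upwards [hae] with ω hω
    rw [consensusErr_eq, Real.norm_of_nonneg (sq_nonneg _)]
    exact sq_le_of_le_mul_one_add (stackNorm_nonneg _) (hb (fun m => ξ m ω) hω.1 k).1 hω.2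
  have hob : ∀ k, ∀ᵐ ω ∂P, ‖optErr xstar (algState f W β α x₀ (fun m => ξ m ω) k).1‖
      ≤ 2 * K ^ 2 * (1 + T ω) := fun k => by
    filter_upwards [hae] with ω hω
    rw [optErr, Real.norm_of_nonneg (sq_nonneg _)]
    exact sq_le_of_le_mul_one_add (norm_nonneg _) (hb (fun m => ξ m ω) hω.1 k).2.2 hω.2
  have hclim : ∀ᵐ ω ∂P, Tendsto
      (fun k => consensusErr (algState f W β α x₀ (fun m => ξ m ω) k).1) atTop (𝓝 0) :=
    hae.mono fun ω hω => (algState_tendsto hf hW hβ hα hαs x₀ (ξ := fun m => ξ m ω) hω.1).1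
  have holim : ∀ᵐ ω ∂P, ∃ D : ℝ, Tendsto
      (fun k => optErr xstar (algState f W β α x₀ (fun m => ξ m ω) k).1) atTop (𝓝 D) := by
    refine hae.mono fun ω hω => ?_
    obtain ⟨v, hv⟩ := (algState_tendsto hf hW hβ hα hαs x₀ (ξ := fun m => ξ m ω) hω.1).2
    exact ⟨_, tendsto_optErr xstar hv⟩
  obtain ⟨hc1, hc2, hc3⟩ := expectation_of_dominated hcm hHi hcb hclim
  -- The limit is random and known only to exist almost surely, so it is selected by `limUnder`; `d`
  -- is its expectation.
  obtain ⟨ho1, ho2, ho3⟩ := expectation_of_dominated hom hHi hob (G := fun ω => limUnder atTop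
    fun k => optErr xstar (algState f W β α x₀ (fun m => ξ m ω) k).1)
    (holim.mono fun ω h => tendsto_nhds_limUnder h)
  rw [integral_zero] at hc3
  exact ⟨hc1, ho1, hc3, ⟨_, ho3⟩, fun k => (hc2 k).trans hHint, fun k => (ho2 k).trans hHint⟩

end Expectation

/-! ### From the scalar recursion to the accuracy bound -/

section Accuracy

lemma le_exp_neg_sum_mul_add {a t D : ℕ → ℝ} {c : ℝ} (ht0 : ∀ k, 0 ≤ t k) (ht1 : ∀ k, t k ≤ 1)
    (hD : ∀ k, 0 ≤ D k) (hc : 0 ≤ c) (ha : a 0 ≤ c)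
    (h : ∀ k, a (k + 1) ≤ (1 - t k) * a k + D k) (k : ℕ) :
    a k ≤ Real.exp (-∑ m ∈ Finset.range k, t m) * c + ∑ m ∈ Finset.range k, D m := by
  induction k with
  | zero => simpa using ha
  | succ k ih =>
    have h1 : 1 - t k ≤ Real.exp (-t k) := by
      have := Real.add_one_le_exp (-t k); linarith
    have h2 : 0 ≤ 1 - t k := by linarith [ht1 k]
    have h3 : 0 ≤ ∑ m ∈ Finset.range k, D m := Finset.sum_nonneg fun m _ => hD m
    rw [Finset.sum_range_succ, Finset.sum_range_succ, neg_add, Real.exp_add]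
    have h4 := mul_le_mul_of_nonneg_left ih h2
    have h5 := mul_le_mul_of_nonneg_right h1
      (mul_nonneg (Real.exp_pos (-∑ m ∈ Finset.range k, t m)).le hc)
    have h6 := mul_le_of_le_one_left h3 (show 1 - t k ≤ 1 by linarith [ht0 k])
    have h7 := h k
    linarith

lemma le_accuracyBound_of_recursion {n p : ℕ} (hn : 0 < n) {L μ γ q₁ q₂ δ ε c₁ c₂ d : ℝ}
    (hL : 0 ≤ L) (hμ : 0 < μ) (hγ : 0 < γ) (hγμ : γ * μ ≤ 1) (hq₁ : q₁ ∈ Set.Ioo (0 : ℝ) 1)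
    (hq₂ : q₂ ∈ Set.Ioo q₁ 1) (hε : 0 < ε) (hc₁ : 0 ≤ c₁) (hc₂ : 0 ≤ c₂) {a : ℕ → ℝ}
    (ha : a 0 ≤ c₁) (hd : Tendsto a atTop (𝓝 d))
    (h : ∀ k, a (k + 1) ≤ (1 - γ * q₁ ^ k * μ) * a k + γ * q₁ ^ k * L ^ 2 / (n * μ) * c₂
      + (1 + 2 * (γ * q₁ ^ k) * L + γ * q₁ ^ k * L ^ 2 / μ)
        * (2 * p * (γ * δ * q₂ / (ε * (q₂ - q₁)) * q₂ ^ k) ^ 2)) :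
    d ≤ accuracyBound n p L μ γ q₁ q₂ δ ε c₁ c₂ := by
  obtain ⟨hq0, hq1⟩ := hq₁
  obtain ⟨hqq, hq21⟩ := hq₂
  have hq20 : 0 < q₂ := hq0.trans hqq
  have hn' : (0 : ℝ) < n := by exact_mod_cast hn
  have hqk : ∀ k, 0 < q₁ ^ k := fun k => by positivity
  have hqk1 : ∀ k, q₁ ^ k ≤ 1 := fun k => pow_le_one₀ hq0.le hq1.le
  obtain ⟨ν₀, hν₀⟩ : ∃ ν₀, ν₀ = γ * δ * q₂ / (ε * (q₂ - q₁)) := ⟨_, rfl⟩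
  rw [← hν₀] at h
  have h2 : q₂ ^ 2 < 1 := by nlinarith
  have h12 : q₁ * q₂ ^ 2 < 1 := by nlinarith
  have hs1 := hasSum_geometric_of_lt_one hq0.le hq1
  have hs2 := hasSum_geometric_of_lt_one (sq_nonneg q₂) h2
  have hs3 := hasSum_geometric_of_lt_one (mul_nonneg hq0.le (sq_nonneg q₂)) h12
  have hst := hs1.mul_left (γ * μ)
  -- The ratios `q₁`, `q₂ ^ 2` and `q₁ * q₂ ^ 2` belong to the consensus error, the noise variance,
  -- and the noise variance multiplied by the stepsize.
  have hsD := ((hs1.mul_left (γ * L ^ 2 / (n * μ) * c₂)).add (hs2.mul_left (2 * p * ν₀ ^ 2))).add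
    (hs3.mul_left ((4 * p * L + 2 * p * L ^ 2 / μ) * γ * ν₀ ^ 2))
  have hle := le_exp_neg_sum_mul_add (a := a) (t := fun k => γ * μ * q₁ ^ k)
    (D := fun k => γ * L ^ 2 / (n * μ) * c₂ * q₁ ^ k + 2 * p * ν₀ ^ 2 * (q₂ ^ 2) ^ k
      + (4 * p * L + 2 * p * L ^ 2 / μ) * γ * ν₀ ^ 2 * (q₁ * q₂ ^ 2) ^ k)
    (fun k => by positivity) (fun k => ?_) (fun k => by positivity) hc₁ ha (fun k => ?_)
  · have hlim := ((Real.continuous_exp.tendsto _).comp hst.tendsto_sum_nat.neg).mul_const c₁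
      |>.add hsD.tendsto_sum_nat
    refine (le_of_tendsto_of_tendsto' hd hlim hle).trans (le_of_eq ?_)
    rw [accuracyBound, hν₀]
    have e1 : q₂ - q₁ ≠ 0 := by linarith
    have e2 : 1 - q₁ ≠ 0 := by linarith
    have e3 : 1 - q₂ ^ 2 ≠ 0 := by linarith
    have e4 : 1 - q₁ * q₂ ^ 2 ≠ 0 := by linarith
    have t1 : γ * μ * (1 - q₁)⁻¹ = μ * γ / (1 - q₁) := by field_simp
    rw [t1]
    have t2 : γ * L ^ 2 / (n * μ) * c₂ * (1 - q₁)⁻¹ = γ * c₂ * L ^ 2 / (n * μ * (1 - q₁)) := by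
      field_simp
    have t3 : 2 * p * (γ * δ * q₂ / (ε * (q₂ - q₁))) ^ 2 * (1 - q₂ ^ 2)⁻¹
        = 2 * p * δ ^ 2 * γ ^ 2 * q₂ ^ 2 / (ε ^ 2 * (q₂ - q₁) ^ 2 * (1 - q₂ ^ 2)) := by
      field_simp
    have t4 : (4 * p * L + 2 * p * L ^ 2 / μ) * γ * (γ * δ * q₂ / (ε * (q₂ - q₁))) ^ 2
          * (1 - q₁ * q₂ ^ 2)⁻¹
        = (4 * p * L + 2 * p * L ^ 2 / μ) *
          (δ ^ 2 * q₂ ^ 2 * γ ^ 3 / (ε ^ 2 * (q₂ - q₁) ^ 2 * (1 - q₁ * q₂ ^ 2))) := by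
      field_simp
    rw [t2, t3, t4]
    ring
  · calc γ * μ * q₁ ^ k ≤ 1 * 1 := by gcongr; exact hqk1 k
      _ = 1 := one_mul 1
  · refine (h k).trans (le_of_eq ?_)
    rw [mul_pow, mul_pow, ← pow_mul, ← pow_mul, mul_comm 2 k]
    field_simp
    ring

/-- The other terms are nonnegative. When `p = 0` the sign of `L` is unknown, but the term linear in
`L` carries the factor `p`. -/
lemma exp_mul_le_accuracyBound {n p : ℕ} {L μ γ q₁ q₂ δ ε c₁ c₂ : ℝ} (hL : p = 0 ∨ 0 ≤ L)
    (hμ : 0 < μ) (hγ : 0 < γ) (hq₁ : q₁ ∈ Set.Ioo (0 : ℝ) 1) (hq₂ : q₂ ∈ Set.Ioo q₁ 1)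
    (hc₂ : 0 ≤ c₂) :
    Real.exp (-(μ * γ / (1 - q₁))) * c₁ ≤ accuracyBound n p L μ γ q₁ q₂ δ ε c₁ c₂ := by
  obtain ⟨hq0, hq1⟩ := hq₁
  obtain ⟨hqq, hq21⟩ := hq₂
  have hq20 : 0 < q₂ := hq0.trans hqq
  have e2 : 0 < 1 - q₁ := by linarith
  have e3 : 0 < 1 - q₂ ^ 2 := by nlinarith
  have e4 : 0 < 1 - q₁ * q₂ ^ 2 := by nlinarith
  have hpL : 0 ≤ 4 * p * L + 2 * p * L ^ 2 / μ := by
    rcases hL with rfl | hL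
    · simp
    · positivity
  have t1 : 0 ≤ γ * c₂ * L ^ 2 / (n * μ * (1 - q₁)) := by positivity
  have t2 : 0 ≤ 2 * p * δ ^ 2 * γ ^ 2 * q₂ ^ 2 / (ε ^ 2 * (q₂ - q₁) ^ 2 * (1 - q₂ ^ 2)) := by
    positivity
  have t3 : 0 ≤ δ ^ 2 * q₂ ^ 2 * γ ^ 3 / (ε ^ 2 * (q₂ - q₁) ^ 2 * (1 - q₁ * q₂ ^ 2)) := by
    positivity
  rw [accuracyBound]
  have := mul_nonneg hpL t3
  linarith

end Accuracy

/-! ### Concrete stepsizes and noise scales -/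

section Assembly

variable {n p : ℕ}

lemma stepsize_succ (γ q₁ : ℝ) (k : ℕ) : stepsize γ q₁ (k + 1) = γ * q₁ ^ k := rfl

lemma noiseScale_succ (γ q₁ q₂ δ ε : ℝ) (k : ℕ) :
    noiseScale γ q₁ q₂ δ ε (k + 1) = γ * δ * q₂ / (ε * (q₂ - q₁)) * q₂ ^ k := rfl

lemma algState_congr (f : Fin n → Vec p → ℝ) (W : Matrix (Fin n) (Fin n) ℝ) (β : ℝ) (α : ℕ → ℝ)
    (x₀ : Stack n p) {ξ η : ℕ → Stack n p} (h : ∀ k, ξ (k + 1) = η (k + 1)) (k : ℕ) :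
    algState f W β α x₀ ξ k = algState f W β α x₀ η k := by
  induction k with
  | zero => rfl
  | succ k ih => rw [algState, algState, ih, h]

/-- Laplace noise has a measurable modification. -/
lemma IsLaplaceNoise.exists_measurable_modification {Ω : Type*} [MeasurableSpace Ω] {P : Measure Ω}
    {ν : ℕ → ℝ} {ξ : ℕ → Ω → Stack n p} (hξ : IsLaplaceNoise P ν ξ) :
    ∃ η : ℕ → Ω → Stack n p, IsLaplaceNoise P ν η ∧ (∀ k, Measurable (η (k + 1))) ∧
      ∀ᵐ ω ∂P, ∀ k, ξ (k + 1) ω = η (k + 1) ω := by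
  have ham : ∀ k i j, AEMeasurable (fun ω => ξ (k + 1) ω i j) P := fun k i j =>
    (hξ.hasLaw (k + 1) (by omega) i j).aemeasurable
  obtain ⟨η, hη⟩ : ∃ η : ℕ → Ω → Stack n p, ∀ k ω i j, η (k + 1) ω i j = (ham k i j).mk _ ω :=
    ⟨fun k ω i => WithLp.toLp 2 fun j => (ham (k - 1) i j).mk _ ω, fun k ω i j => rfl⟩
  have heq : ∀ k i j, (fun ω => ξ (k + 1) ω i j) =ᵐ[P] fun ω => η (k + 1) ω i j := fun k i j => by
    simp_rw [hη]
    exact (ham k i j).ae_eq_mk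
  refine ⟨η, ⟨fun k hk i j => ?_, hξ.indep.congr fun a => heq a.1 a.2.1 a.2.2⟩,
    fun k => measurable_stack fun i j => ?_, ?_⟩
  · obtain ⟨k, rfl⟩ : ∃ m, k = m + 1 := ⟨k - 1, by omega⟩
    exact (hξ.hasLaw (k + 1) hk i j).congr (heq k i j).symm
  · simp_rw [hη]
    exact (ham k i j).measurable_mk
  · have h : ∀ᵐ ω ∂P, ∀ k i j, ξ (k + 1) ω i j = η (k + 1) ω i j :=
      ae_all_iff.2 fun k => ae_all_iff.2 fun i => ae_all_iff.2 fun j => heq k i j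
    filter_upwards [h] with ω hω k
    ext i j
    exact hω k i j

/-- For small initial stepsizes, any uniform bounds on the expected errors control the limiting
optimization error. -/
lemma le_accuracyBound_of_small_stepsize {f : Fin n → Vec p → ℝ} {L μ : ℝ}
    {W : Matrix (Fin n) (Fin n) ℝ} {Ω : Type*} [MeasurableSpace Ω] {P : Measure Ω}
    [IsProbabilityMeasure P] {ξ : ℕ → Ω → Stack n p} (hW : IsWeightMatrix W)
    (hf : ∀ i, IsSmoothStronglyConvex L μ (f i)) (hμ : 0 < μ) (hμL : μ ≤ L) {xstar : Vec p}
    (hx : ∀ x, globalCost f xstar ≤ globalCost f x) (β : ℝ) {γ q₁ q₂ δ ε : ℝ} (hγ : 0 < γ)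
    (hq₁ : q₁ ∈ Set.Ioo (0 : ℝ) 1) (hq₂ : q₂ ∈ Set.Ioo q₁ 1) (hδ : 0 < δ) (hε : 0 < ε)
    (x₀ : Stack n p) (hξ : IsLaplaceNoise P (noiseScale γ q₁ q₂ δ ε) ξ)
    (hm : ∀ k, Measurable (ξ (k + 1)))
    (hcons : ∀ k, Integrable (fun ω =>
      consensusErr (algState f W β (stepsize γ q₁) x₀ (fun m => ξ m ω) k).1) P)
    (hopt : ∀ k, Integrable (fun ω =>
      optErr xstar (algState f W β (stepsize γ q₁) x₀ (fun m => ξ m ω) k).1) P) {d : ℝ}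
    (hd : Tendsto (fun k => ∫ ω,
      optErr xstar (algState f W β (stepsize γ q₁) x₀ (fun m => ξ m ω) k).1 ∂P) atTop (𝓝 d))
    (hγL : γ ≤ 2 / (μ + L)) {c₁ c₂ : ℝ}
    (hc₁ : ∀ k, ∫ ω,
      optErr xstar (algState f W β (stepsize γ q₁) x₀ (fun m => ξ m ω) k).1 ∂P ≤ c₁)
    (hc₂ : ∀ k, ∫ ω,
      consensusErr (algState f W β (stepsize γ q₁) x₀ (fun m => ξ m ω) k).1 ∂P ≤ c₂) :
    d ≤ accuracyBound n p L μ γ q₁ q₂ δ ε c₁ c₂ := by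
  have hq20 : 0 < q₂ := hq₁.1.trans hq₂.1
  have hq21 : 0 < q₂ - q₁ := sub_pos.2 hq₂.1
  have hn' : (0 : ℝ) < n := by exact_mod_cast hW.pos
  have hν : ∀ k, 0 < noiseScale γ q₁ q₂ δ ε (k + 1) := fun k => by
    rw [noiseScale_succ]; positivity
  have hα : ∀ k, 0 ≤ stepsize γ q₁ (k + 1) := fun k => by
    have := hq₁.1
    rw [stepsize_succ]; positivity
  have hαγ : ∀ k, stepsize γ q₁ (k + 1) ≤ γ := fun k => by
    rw [stepsize_succ]
    exact mul_le_of_le_one_right hγ.le (pow_le_one₀ hq₁.1.le hq₁.2.le)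
  have hγμ : γ * μ ≤ 1 := by
    have : γ * (μ + L) ≤ 2 := (le_div_iff₀ (by linarith)).1 hγL
    nlinarith
  have hcons0 : ∀ s : Stack n p, 0 ≤ consensusErr s := fun s => by
    rw [consensusErr_eq]; exact sq_nonneg _
  refine le_accuracyBound_of_recursion hW.pos (hμ.le.trans hμL) hμ hγ hγμ hq₁ hq₂ hε
    ((integral_nonneg fun ω => sq_nonneg _).trans (hc₁ 0))
    ((integral_nonneg fun ω => hcons0 _).trans (hc₂ 0)) (hc₁ 0) hd fun k => ?_
  refine (integral_optErr_algState_succ_le hW hf hμ hμL hx β x₀ hξ hν hm hcons hopt k (hα k)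
    ((hαγ k).trans hγL)).trans ?_
  have h0 : 0 ≤ stepsize γ q₁ (k + 1) * L ^ 2 / (n * μ) := by
    have := hα k
    positivity
  have h1 := mul_le_mul_of_nonneg_left (hc₂ k) h0
  rw [stepsize_succ] at h1 ⊢
  rw [noiseScale_succ]
  linarith

end Assembly

end DPOpt

/-! ### The main theorem: choice of the constants -/

theorem theorem2 {n p : ℕ} (f : Fin n → Vec p → ℝ) (L μ : ℝ) (hμ : 0 < μ)
    (hf : ∀ i, IsSmoothStronglyConvex L μ (f i))
    (xstar : Vec p) (hxstar : ∀ x, globalCost f xstar ≤ globalCost f x)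
    (W : Matrix (Fin n) (Fin n) ℝ) (hW : IsWeightMatrix W)
    (β γ q₁ q₂ δ θ : ℝ) (hβ : 0 < β) (hγ : 0 < γ) (hγβ : γ * β ≤ 1)
    (hq₁ : q₁ ∈ Set.Ioo (0 : ℝ) 1) (hq₂ : q₂ ∈ Set.Ioo q₁ 1) (hδ : 0 < δ) (hθ : 1 < θ)
    -- the condition on `q₁`, with the denominator multiplied out
    (hcond : q₁ ^ 2 * (48 * (θ + 1) * (2 + sigma W β γ q₁ ^ 2) * (3 + sigma W β γ q₁ ^ 2) *
      specNorm (W - 1) ^ 2) ≤ (1 - sigma W β γ q₁ ^ 2) ^ 4)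
    (x₀ : Stack n p) :
    sigma W β γ q₁ < 1 ∧
    -- the constant `C` depends neither on the privacy budget nor on the noise
    ∃ C : ℝ, 0 < C ∧
      ∀ (ε : ℝ), 0 < ε → ∀ (Ω : Type*) [MeasurableSpace Ω] (P : Measure Ω) [IsProbabilityMeasure P]
        (ξ : ℕ → Ω → Stack n p), IsLaplaceNoise P (noiseScale γ q₁ q₂ δ ε) ξ →
      ∀ x : ℕ → Ω → Stack n p,
        (∀ k ω, x k ω = (algState f W β (stepsize γ q₁) x₀ (fun m => ξ m ω) k).1) →
      -- the expectations are finite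
      (∀ k, Integrable (fun ω => consensusErr (x k ω)) P) ∧
      (∀ k, Integrable (fun ω => optErr xstar (x k ω)) P) ∧
      -- mean-square consensus
      Tendsto (fun k => ∫ ω, consensusErr (x k ω) ∂P) atTop (𝓝 0) ∧
      -- the optimization accuracy `d` exists and is bounded
      ∃ d : ℝ, Tendsto (fun k => ∫ ω, optErr xstar (x k ω) ∂P) atTop (𝓝 d) ∧
        (∃ c₁ c₂ : ℝ, 0 < c₁ ∧ 0 < c₂ ∧
          c₁ ≤ C * (1 + 1 / ε ^ 2) ∧ c₂ ≤ C * (1 + 1 / ε ^ 2) ∧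
          (∀ k, ∫ ω, optErr xstar (x k ω) ∂P ≤ c₁) ∧
          (∀ k, ∫ ω, consensusErr (x k ω) ∂P ≤ c₂) ∧
          d ≤ accuracyBound n p L μ γ q₁ q₂ δ ε c₁ c₂) ∧
        -- if the initial stepsize is small, any uniform bounds can serve as the constants
        (γ ≤ 2 / (μ + L) → ∀ c₁ c₂ : ℝ,
          (∀ k, ∫ ω, optErr xstar (x k ω) ∂P ≤ c₁) →
          (∀ k, ∫ ω, consensusErr (x k ω) ∂P ≤ c₂) →
          d ≤ accuracyBound n p L μ γ q₁ q₂ δ ε c₁ c₂) := by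
  have hσ := hW.sigma_lt_one hβ hγ hγβ hq₁
  refine ⟨hσ, ?_⟩
  have hq20 : 0 < q₂ := hq₁.1.trans hq₂.1
  have hq21 : 0 < q₂ - q₁ := sub_pos.2 hq₂.1
  have hq10 := hq₁.1
  have hα : ∀ k, 0 ≤ stepsize γ q₁ (k + 1) := fun k => by
    rw [stepsize_succ]; positivity
  have hαγ : ∀ k, stepsize γ q₁ (k + 1) ≤ γ := fun k => by
    rw [stepsize_succ]
    exact mul_le_of_le_one_right hγ.le (pow_le_one₀ hq₁.1.le hq₁.2.le)
  have hαs : Summable fun k => stepsize γ q₁ (k + 1) := by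
    simp_rw [stepsize_succ]
    exact (summable_geometric_of_lt_one hq₁.1.le hq₁.2).mul_left γ
  obtain ⟨K, hK, hmain⟩ := exists_expectation_bound hW hf xstar hβ hα hαγ hαs x₀ hq20 hq₂.2
  obtain ⟨B, hB⟩ : ∃ B, B = γ * δ * q₂ / (q₂ - q₁) := ⟨_, rfl⟩
  have hB0 : 0 < B := by rw [hB]; positivity
  -- `E` is the inverse of the exponential factor of `c₁` in the accuracy bound.
  obtain ⟨E, hE⟩ : ∃ E, E = Real.exp (μ * γ / (1 - q₁)) := ⟨_, rfl⟩
  have hE1 : 1 ≤ E := by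
    have : 0 < 1 - q₁ := sub_pos.2 hq₁.2
    rw [hE]
    exact Real.one_le_exp (by positivity)
  refine ⟨E * (K * (1 + B ^ 2)), by positivity, ?_⟩
  intro ε hε Ω _ P _ ξ hξ x hx
  -- The law hypothesis gives only a.e. measurability, whereas the history must consist of
  -- measurable sets.
  obtain ⟨η, hη, hηm, hae⟩ := hξ.exists_measurable_modification
  have hν₀ : 0 < γ * δ * q₂ / (ε * (q₂ - q₁)) := by positivity
  obtain ⟨hci, hoi, hc0, ⟨d, hd⟩, hcK, hoK⟩ := hmain Ω P _ η _ hη hηm hν₀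
    fun k => noiseScale_succ γ q₁ q₂ δ ε k
  have hxη : ∀ k, ∀ᵐ ω ∂P,
      (algState f W β (stepsize γ q₁) x₀ (fun m => η m ω) k).1 = x k ω := fun k => by
    filter_upwards [hae] with ω hω
    rw [hx, algState_congr f W β _ x₀ (ξ := fun m => ξ m ω) (η := fun m => η m ω) hω]
  have hcx : ∀ k, (fun ω => consensusErr
      (algState f W β (stepsize γ q₁) x₀ (fun m => η m ω) k).1) =ᵐ[P]
      fun ω => consensusErr (x k ω) := fun k => (hxη k).mono fun ω h => by simp only [h]
  have hox : ∀ k, (fun ω => optErr xstar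
      (algState f W β (stepsize γ q₁) x₀ (fun m => η m ω) k).1) =ᵐ[P]
      fun ω => optErr xstar (x k ω) := fun k => (hxη k).mono fun ω h => by simp only [h]
  have hcI := fun k => integral_congr_ae (hcx k)
  have hoI := fun k => integral_congr_ae (hox k)
  have hscale : K * (1 + (γ * δ * q₂ / (ε * (q₂ - q₁))) ^ 2)
      ≤ K * (1 + B ^ 2) * (1 + 1 / ε ^ 2) := by
    have h1 : (γ * δ * q₂ / (ε * (q₂ - q₁))) ^ 2 = B ^ 2 * (1 / ε ^ 2) := by
      rw [hB]; field_simp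
    rw [h1]
    exact scale_le (sq_nonneg _) (by positivity) hK.le
  have hC0 : 0 < K * (1 + B ^ 2) * (1 + 1 / ε ^ 2) := by positivity
  have hCE : K * (1 + B ^ 2) * (1 + 1 / ε ^ 2)
      ≤ E * (K * (1 + B ^ 2)) * (1 + 1 / ε ^ 2) := by
    rw [mul_assoc E]
    exact le_mul_of_one_le_left hC0.le hE1
  -- Comparing the two constants needs two distinct points, hence a nontrivial space.
  have hL : p = 0 ∨ μ ≤ L := by
    rcases Nat.eq_zero_or_pos p with hp | hp
    · exact Or.inl hp
    · refine Or.inr ((hf ⟨0, hW.pos⟩).le_of_ne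
        (x := EuclideanSpace.single ⟨0, hp⟩ (1 : ℝ)) (y := 0) fun h => ?_)
      simpa using congrArg norm h
  have hL' : p = 0 ∨ 0 ≤ L := hL.imp_right hμ.le.trans
  have hcons0 : ∀ s : Stack n p, 0 ≤ consensusErr s := fun s => by
    rw [consensusErr_eq]; exact sq_nonneg _
  refine ⟨fun k => (hci k).congr (hcx k), fun k => (hoi k).congr (hox k), ?_, d, ?_, ?_, ?_⟩
  · simpa only [hcI] using hc0
  · simpa only [hoI] using hd
  -- Both constants equal `C * (1 + 1 / ε ^ 2)`, which contains the factor `E`; multiplied by the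
  -- exponential, `c₁` is still a uniform bound and hence at least `d`.
  · refine ⟨_, _, hC0.trans_le hCE, hC0.trans_le hCE, le_rfl, le_rfl, fun k => ?_, fun k => ?_, ?_⟩
    · rw [← hoI]
      exact (hoK k).trans (hscale.trans hCE)
    · rw [← hcI]
      exact (hcK k).trans (hscale.trans hCE)
    · have hd' : d ≤ K * (1 + B ^ 2) * (1 + 1 / ε ^ 2) :=
        le_of_tendsto' hd fun k => (hoK k).trans hscale
      refine hd'.trans (le_trans (le_of_eq ?_)
        (exp_mul_le_accuracyBound hL' hμ hγ hq₁ hq₂ (hC0.trans_le hCE).le))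
      rw [hE, mul_assoc (Real.exp (μ * γ / (1 - q₁))), ← mul_assoc (Real.exp (-_)),
        ← Real.exp_add, neg_add_cancel, Real.exp_zero, one_mul]
  · intro hγL c₁ c₂ hc₁ hc₂
    simp only [← hoI] at hc₁
    simp only [← hcI] at hc₂
    rcases hL with hp | hμL
    -- In dimension zero the optimization error vanishes identically, so `d = 0`.
    · have h0 : ∀ s : Stack n p, optErr xstar s = 0 := fun s => by
        subst hp
        rw [optErr, Subsingleton.elim (rowAvg s) xstar]
        simp
      simp only [h0, integral_zero] at hd hc₁
      rw [tendsto_nhds_unique hd tendsto_const_nhds]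
      exact (mul_nonneg (Real.exp_pos _).le (hc₁ 0)).trans (exp_mul_le_accuracyBound hL' hμ hγ hq₁
        hq₂ ((integral_nonneg fun ω => hcons0 _).trans (hc₂ 0)))
    · exact le_accuracyBound_of_small_stepsize hW hf hμ hμL hxstar β hγ hq₁ hq₂ hδ hε x₀ hη hηm
        hci hoi hd hγL hc₁ hc₂
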